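/- Let $q>0$ and let $V_q(u)=1-u$ for $u\le \frac{q}{q+1}$ and $V_q(u)=\frac{1}{u^q}\frac{q^q}{(q+1)^{q+1}}$ for $u>\frac{q}{q+1}$ be the generalized distance weighted discrimination (DWD) loss, extended by $V_q(\infty)=0$ and $V_q(-\infty)=\infty$. Let $\mathcal X\subset\mathbb R^p$ be compact, let $(X,Y)$ be a random pair with values in $\mathcal X\times\{-1,1\}$, let $\eta(x)=P(Y=1\mid X=x)$, and assume $P(\eta(X)=1/2)=0$. Put $$\tilde f(x)=\frac{q}{q+1}\left[\left(\frac{\eta(x)}{1-\eta(x)}\right)^{\frac1{q+1}}I(\eta(x)>1/2)-\left(\frac{1-\eta(x)}{\eta(x)}\right)^{\frac1{q+1}}I(\eta(x)<1/2)\right],$$ with value $\infty$ where $\eta(x)=1$ and $-\infty$ where $\eta(x)=0$. Let $f^\star(x)=\mathrm{sign}(\eta(x)-1/2)$ be the Bayes rule, and $R(f)=P(Y\ne\mathrm{sign}(f(X)))$ the misclassification error of a function $f$, where $\mathrm{sign}(0)=0$. Let $K$ be a kernel on $\mathcal X$ with reproducing kernel Hilbert space $\mathcal H_K$, and suppose that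 $K$ is universal: $\mathcal H_K$ consists of continuous functions, and for every continuous $g:\mathcal X\to\mathbb R$ and every $\epsilon>0$ there is $f\in\mathcal H_K$ with $\|f-g\|_\infty<\epsilon$. Let $(x_1,y_1),(x_2,y_2),\dots$ be independent copies of $(X,Y)$, let $(\lambda_n)$ be a sequence of real numbers, and for each $n\ge1$ let $\hat f_n$ be a solution of the kernel DWD problem $$\min_{f\in\mathcal H_K}\left[\frac1n\sum_{i=1}^nV_q\big(y_if(x_i)\big)+\lambda_n\|f\|_{\mathcal H_K}^2\right].$$ Define the approximation error and the estimation error by $$\varepsilon_A=\inf_{f\in\mathcal H_K}E\,V_q(Yf(X))-E\,V_q(Y\tilde f(X)),\qquad \varepsilon_E(\hat f_n)=E_{XY}V_q(Y\hat f_n(X))-\inf_{f\in\mathcal H_K}E\,V_q(Yf(X)),$$ where $E_{XY}$ is the expectation over a pair $(X,Y)$ independent of the sample. Then: (1) $\varepsilon_A=0$. (2) If $B=\sup_{x\in\mathcal X}K(x,x)<\infty$, $\lambda_n\to0$ and $n\lambda_n\to\infty$, then $\lim_{n\to\infty}P(\varepsilon_E(\hat f_n)>\epsilon)=0$ for every $\epsilon>0$.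 Moreover, under the hypotheses of (2), $R(\hat f_n)\to R(f^\star)$ in probability, that is, kernel DWD is Bayes risk consistent. -/

import Mathlib

open MeasureTheory ProbabilityTheory Filter
open scoped ENNReal Topology

noncomputable section

namespace DWD

/-- The generalized distance weighted discrimination loss `V_q` on the real line. -/
def loss (q u : ℝ) : ℝ :=
  if u ≤ q / (q + 1) then 1 - u
  else 1 / u ^ q * (q ^ q / (q + 1) ^ (q + 1))

/-- The loss `V_q` extended to `[-∞, ∞]` by its limits `V_q(-∞) = ∞` and `V_q(∞) = 0`. -/
def lossExt (q : ℝ) : EReal → ℝ≥0∞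
  | ⊥ => ⊤
  | ⊤ => 0
  | (u : ℝ) => ENNReal.ofReal (loss q u)

section Population

variable {X : Type*} [MeasurableSpace X]

/-- The population `V_q`-risk `E[V_q(Y g(X))]` of an extended-real-valued function `g`, where
`(X, Y)` has joint law `ρ`. -/
def lossRisk (q : ℝ) (ρ : Measure (X × ℝ)) (g : X → EReal) : ℝ≥0∞ :=
  ∫⁻ z, lossExt q ((z.2 : EReal) * g z.1) ∂ρ

/-- The conditional class probability `η(x) = P(Y = 1 | X = x)`. -/
def condProb (ρ : Measure (X × ℝ)) [IsFiniteMeasure ρ] (x : X) : ℝ :=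
  (ρ.condKernel x).real {1}

/-- The population minimizer of the `V_q`-risk,
`q/(q+1) * [(η/(1-η))^(1/(q+1)) I(η > 1/2) - ((1-η)/η)^(1/(q+1)) I(η < 1/2)]`.
It is `∞` where `η = 1` and `-∞` where `η = 0`. -/
def popMinimizer (q : ℝ) (ρ : Measure (X × ℝ)) [IsFiniteMeasure ρ] (x : X) : EReal :=
  let η := condProb ρ x
  if 1 / 2 < η then
    if η < 1 then ((q / (q + 1) * (η / (1 - η)) ^ (1 / (q + 1)) : ℝ) : EReal) else ⊤
  else if η < 1 / 2 then
    if 0 < η then ((-(q / (q + 1) * ((1 - η) / η) ^ (1 / (q + 1))) : ℝ) : EReal) else ⊥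
  else 0

/-- The misclassification error `R(f) = P(Y ≠ sign(f(X)))`. -/
def misclass (ρ : Measure (X × ℝ)) (f : X → ℝ) : ℝ :=
  ρ.real {z | z.2 ≠ Real.sign (f z.1)}

/-- The Bayes rule `f⋆(x) = sign(η(x) - 1/2)`. -/
def bayesRule (ρ : Measure (X × ℝ)) [IsFiniteMeasure ρ] (x : X) : ℝ :=
  Real.sign (condProb ρ x - 1 / 2)

end Population

section Kernel

variable {X : Type*}

/-- `H` is the reproducing kernel Hilbert space of real-valued functions on `X` generated by the
kernel `K`. -/
def IsRKHSOf (H : Type*) [NormedAddCommGroup H] [InnerProductSpace ℝ H] [CompleteSpace H]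
    [RKHS ℝ H X ℝ] (K : X → X → ℝ) : Prop :=
  ∀ x y, RKHS.kernel H x y 1 = K x y

/-- A function space `H` on a (compact) space `X` is dense in `C(X)`: it consists of continuous
functions, and every continuous function is a uniform limit of functions of `H`. For the
reproducing kernel Hilbert space `H` of a kernel, this says that the kernel is universal. -/
def IsUniversal (H : Type*) [NormedAddCommGroup H] [InnerProductSpace ℝ H]
    [TopologicalSpace X] [RKHS ℝ H X ℝ] : Prop :=
  (∀ f : H, Continuous (f : X → ℝ)) ∧
    ∀ (g : C(X, ℝ)) (ε : ℝ), 0 < ε → ∃ f : H, ∀ x, |f x - g x| < ε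

variable {H : Type*} [NormedAddCommGroup H] [InnerProductSpace ℝ H] [RKHS ℝ H X ℝ]

/-- The regularized empirical risk `(1/n) ∑ V_q(y_i f(x_i)) + lam * ‖f‖²` of `f ∈ H` on the
first `n` terms of a sequence `z` of labelled points. -/
def regEmpRisk (q lam : ℝ) (n : ℕ) (z : ℕ → X × ℝ) (f : H) : ℝ :=
  1 / (n : ℝ) * ∑ i ∈ Finset.range n, loss q ((z i).2 * f (z i).1) + lam * ‖f‖ ^ 2

/-- `f` is a solution of the kernel DWD problem on the first `n` terms of `z`. -/
def IsKernelDWD (q lam : ℝ) (n : ℕ) (z : ℕ → X × ℝ) (f : H) : Prop :=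
  ∀ g : H, regEmpRisk q lam n z f ≤ regEmpRisk q lam n z g

variable [MeasurableSpace X]

variable (H) in
/-- The smallest population `V_q`-risk over `H`. -/
def infRisk (q : ℝ) (ρ : Measure (X × ℝ)) : ℝ≥0∞ :=
  ⨅ f : H, lossRisk q ρ (fun x => (f x : EReal))

variable (H) in
/-- The approximation error `ε_A`. -/
def approxError (q : ℝ) (ρ : Measure (X × ℝ)) [IsFiniteMeasure ρ] : EReal :=
  (infRisk H q ρ : EReal) - (lossRisk q ρ (popMinimizer q ρ) : EReal)

/-- The estimation error `ε_E(f)`. -/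
def estError (q : ℝ) (ρ : Measure (X × ℝ)) (f : H) : EReal :=
  (lossRisk q ρ (fun x => (f x : EReal)) : EReal) - (infRisk H q ρ : EReal)

end Kernel

end DWD

end

/-! The loss `V_q` is convex, nonincreasing and 1-Lipschitz, because at every point it has a
supporting line with slope in [-1, 0] (`exists_subgradient_loss`). Given X = x, a score u has risk η
V_q(u) + (1-η) V_q(-u). This is minimized at f̃(x), and a score whose sign disagrees with the Bayes
rule pays at least q/(q+1)·|2η-1| more (`calibration`). After integration, f̃ has the least risk,
and the excess risk of f bounds the integral of q/(q+1)·|2η-1| over the points where f has the wrong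
sign.

Approximation (`infRisk_eq`): truncating f̃ costs little risk, a bounded function is L¹-close to a
continuous one, and a continuous one is uniformly close to H. The Lipschitz loss turns these
distances into risks.

Estimation (`lintegral_lossRisk_le`): the penalty makes the objective strongly convex, so changing
one sample point moves the solution by O(κ/(nλ)) in norm, where |f(x)| ≤ κ‖f‖. Exchanging a training
point with a fresh one then bounds the expected risk by the risk of any fixed f plus λ‖f‖² +
4κ²/(nλ), and Markov's inequality gives convergence in probability. Since f̂_n need not be
measurable, the argument runs on a measurable near-minimizer chosen from a dense sequence; strong
convexity keeps f̂_n close to it.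

Bayes consistency: the excess risk tends to 0 in probability, and P(η = 1/2) = 0 makes small margins
|2η-1| rare, so wrong signs are rare too. -/

namespace DWD

/-! ### Convexity and Lipschitz properties of the loss -/

section Loss

variable {q : ℝ}

lemma one_sub_mul_le_rpow_neg (q : ℝ) (hq : 0 < q) {x : ℝ} (hx : 0 < x) :
    1 - q * (x - 1) ≤ x ^ (-q) := by
  have h1 := Real.add_one_le_exp (Real.log x * (-q))
  have h2 := Real.log_le_sub_one_of_pos hx
  rw [Real.rpow_def_of_pos hx]
  nlinarith

lemma loss_of_le {u : ℝ} (h : u ≤ q / (q + 1)) : loss q u = 1 - u := if_pos h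

/-- In the variable r = u(q+1)/q the tail is a pure power; at r = 1 the two branches meet. -/
lemma loss_scaled (hq : 0 < q) {r : ℝ} (hr : 1 ≤ r) :
    loss q (q / (q + 1) * r) = r ^ (-q) / (q + 1) := by
  have hc : 0 < q / (q + 1) := by positivity
  rcases hr.eq_or_lt with rfl | hr
  · rw [mul_one, loss_of_le le_rfl, Real.one_rpow]
    field_simp
    ring
  · have h0 : 0 < r := by linarith
    rw [loss, if_neg (by nlinarith), Real.mul_rpow hc.le h0.le,
      Real.div_rpow hq.le (by positivity), Real.rpow_add (by positivity), Real.rpow_one,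
      Real.rpow_neg h0.le]
    have := Real.rpow_pos_of_pos hq q
    have := Real.rpow_pos_of_pos (show 0 < q + 1 by positivity) q
    have := Real.rpow_pos_of_pos h0 q
    field_simp

lemma rpow_tangent (hq : 0 < q) {r s : ℝ} (hr : 0 < r) (hs : 0 < s) :
    s ^ (-q) / (q + 1) - s ^ (-(q + 1)) * (q / (q + 1) * r - q / (q + 1) * s)
      ≤ r ^ (-q) / (q + 1) := by
  have h := one_sub_mul_le_rpow_neg q hq (div_pos hr hs)
  have e1 : s ^ (-(q + 1)) = s ^ (-q) / s := by
    rw [show -(q + 1) = -q - 1 by ring, Real.rpow_sub_one hs.ne']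
  have e2 : r ^ (-q) = s ^ (-q) * (r / s) ^ (-q) := by
    rw [← Real.mul_rpow hs.le (by positivity), mul_div_cancel₀ _ hs.ne']
  have h3 := mul_le_mul_of_nonneg_left h (Real.rpow_pos_of_pos hs (-q)).le
  rw [e1, e2, show s ^ (-q) / (q + 1) - s ^ (-q) / s * (q / (q + 1) * r - q / (q + 1) * s)
    = (s ^ (-q) * (1 - q * (r / s - 1))) / (q + 1) by field_simp]
  gcongr

/-- On the power branch this is `rpow_tangent`. To the left of q/(q+1) the loss has slope -1, while
the tangent has slope at least -1, so the line stays below. -/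
lemma loss_tangent (hq : 0 < q) {s : ℝ} (hs : 1 ≤ s) (u : ℝ) :
    s ^ (-q) / (q + 1) - s ^ (-(q + 1)) * (u - q / (q + 1) * s) ≤ loss q u := by
  have hc : 0 < q / (q + 1) := by positivity
  have hs0 : 0 < s := by linarith
  rcases le_total u (q / (q + 1)) with hu | hu
  · have h1 := rpow_tangent hq one_pos hs0
    have h2 : s ^ (-(q + 1)) ≤ 1 := Real.rpow_le_one_of_one_le_of_nonpos hs (by linarith)
    have h3 : 1 / (q + 1) = 1 - q / (q + 1) := by field_simp; ring
    rw [Real.one_rpow, mul_one, h3] at h1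
    rw [loss_of_le hu]
    nlinarith
  · have e : u = q / (q + 1) * (u / (q / (q + 1))) := by field_simp
    have hr : 1 ≤ u / (q / (q + 1)) := by rwa [one_le_div hc]
    have h := rpow_tangent hq (zero_lt_one.trans_le hr) hs0
    rw [← loss_scaled hq hr, ← e] at h
    exact h

lemma one_sub_le_loss (hq : 0 < q) (u : ℝ) : 1 - u ≤ loss q u := by
  have h := loss_tangent hq le_rfl u
  have h3 : 1 / (q + 1) = 1 - q / (q + 1) := by field_simp; ring
  rw [Real.one_rpow, Real.one_rpow, h3] at h
  linarith

lemma exists_subgradient_loss (hq : 0 < q) (w : ℝ) :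
    ∃ m, -1 ≤ m ∧ m ≤ 0 ∧ ∀ u, loss q w + m * (u - w) ≤ loss q u := by
  have hc : 0 < q / (q + 1) := by positivity
  rcases le_total w (q / (q + 1)) with hw | hw
  · refine ⟨-1, le_rfl, by norm_num, fun u => ?_⟩
    rw [loss_of_le hw]
    linarith [one_sub_le_loss hq u]
  · have e : w = q / (q + 1) * (w / (q / (q + 1))) := by field_simp
    have hr : 1 ≤ w / (q / (q + 1)) := by rwa [one_le_div hc]
    refine ⟨-(w / (q / (q + 1))) ^ (-(q + 1)), ?_, ?_, fun u => ?_⟩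
    · rw [neg_le_neg_iff]
      exact Real.rpow_le_one_of_one_le_of_nonpos hr (by linarith)
    · rw [Left.neg_nonpos_iff]
      positivity
    · have h := loss_tangent hq hr u
      rw [← loss_scaled hq hr, ← e] at h
      linarith

lemma loss_antitone (hq : 0 < q) : Antitone (loss q) := by
  intro u w h
  obtain ⟨m, -, h2, h3⟩ := exists_subgradient_loss hq w
  nlinarith [h3 u]

lemma abs_loss_sub_le (hq : 0 < q) (u w : ℝ) : |loss q u - loss q w| ≤ |u - w| := by
  have key : ∀ a b : ℝ, loss q a - loss q b ≤ |a - b| := by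
    intro a b
    obtain ⟨m, h1, h2, h3⟩ := exists_subgradient_loss hq a
    have h4 := h3 b
    have h5 : -m * (b - a) ≤ -m * |a - b| :=
      mul_le_mul_of_nonneg_left (by rw [abs_sub_comm]; exact le_abs_self _) (by linarith)
    nlinarith [abs_nonneg (a - b)]
  rw [abs_le]
  constructor
  · have := key w u
    rw [abs_sub_comm] at this
    linarith
  · exact key u w

lemma loss_midpoint_le (hq : 0 < q) (a b : ℝ) :
    loss q ((a + b) / 2) ≤ (loss q a + loss q b) / 2 := by
  obtain ⟨m, -, -, h⟩ := exists_subgradient_loss hq ((a + b) / 2)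
  have h1 := h a
  have h2 := h b
  nlinarith

lemma loss_nonneg (hq : 0 < q) (u : ℝ) : 0 ≤ loss q u := by
  rw [loss]
  split_ifs with h
  · have : q / (q + 1) ≤ 1 := by rw [div_le_one (by positivity)]; linarith
    linarith
  · have : 0 < u := lt_trans (by positivity) (not_le.1 h)
    positivity

lemma loss_zero (hq : 0 < q) : loss q 0 = 1 := by
  rw [loss_of_le (by positivity), sub_zero]

lemma continuous_loss (hq : 0 < q) : Continuous (loss q) :=
  (LipschitzWith.of_dist_le_mul (K := 1) fun u w => by
    simpa [Real.dist_eq] using abs_loss_sub_le hq u w).continuous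

lemma exists_loss_le (hq : 0 < q) {ε : ℝ} (hε : 0 < ε) : ∃ M, 0 ≤ M ∧ loss q M ≤ ε := by
  obtain ⟨r, h1, h2⟩ := (((tendsto_rpow_neg_atTop hq).eventually (gt_mem_nhds hε)).and
    (eventually_ge_atTop 1)).exists
  refine ⟨q / (q + 1) * r, by positivity, ?_⟩
  rw [loss_scaled hq h2]
  refine le_trans (div_le_self (by positivity) (by linarith)) h1.le

end Loss

end DWD

noncomputable section

namespace DWD

/-! ### Pointwise minimization of the conditional risk -/

section Calibration

variable {q : ℝ}

lemma lossExt_coe (q u : ℝ) : lossExt q (u : EReal) = ENNReal.ofReal (loss q u) := rfl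

lemma lossExt_top (q : ℝ) : lossExt q ⊤ = 0 := rfl

lemma lossExt_bot (q : ℝ) : lossExt q ⊥ = ⊤ := rfl

lemma lossExt_antitone (hq : 0 < q) : Antitone (lossExt q) := by
  intro a b h
  induction a with
  | bot => rw [lossExt_bot]; exact le_top
  | top => rw [top_le_iff.1 h]
  | coe a =>
    induction b with
    | bot => simp at h
    | top => rw [lossExt_top]; exact zero_le
    | coe b =>
      rw [lossExt_coe, lossExt_coe]
      exact ENNReal.ofReal_le_ofReal (loss_antitone hq (EReal.coe_le_coe_iff.1 h))

/-- The minimizer of the conditional `V_q`-risk as a function of the class probability. -/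
def optScore (q η : ℝ) : EReal :=
  if 1 / 2 < η then
    if η < 1 then ((q / (q + 1) * (η / (1 - η)) ^ (1 / (q + 1)) : ℝ) : EReal) else ⊤
  else if η < 1 / 2 then
    if 0 < η then ((-(q / (q + 1) * ((1 - η) / η) ^ (1 / (q + 1))) : ℝ) : EReal) else ⊥
  else 0

lemma optScore_one_sub (q η : ℝ) : optScore q (1 - η) = -optScore q η := by
  unfold optScore
  rcases lt_trichotomy η (1 / 2) with h | h | h
  · rw [if_pos (by linarith), if_neg (show ¬1 / 2 < η by linarith), if_pos h, sub_sub_cancel]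
    by_cases h0 : 0 < η
    · rw [if_pos (by linarith), if_pos h0, EReal.coe_neg, neg_neg]
    · rw [if_neg (by linarith), if_neg h0, EReal.neg_bot]
  · rw [if_neg (by linarith), if_neg (by linarith), if_neg (by linarith), if_neg (by linarith),
      neg_zero]
  · rw [if_neg (by linarith), if_pos (by linarith), if_pos h, sub_sub_cancel]
    by_cases h0 : η < 1
    · rw [if_pos (by linarith), if_pos h0, EReal.coe_neg]
    · rw [if_neg (by linarith), if_neg h0, EReal.neg_top]

/-- The first summand is the minimal conditional risk; the second is the penalty for a nonpositive
score. -/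
lemma conditional_risk_bound (hq : 0 < q) {η : ℝ} (h0 : 1 / 2 < η) (h1 : η < 1) (u : ℝ) :
    (1 - η) * (1 + (η / (1 - η)) ^ (1 / (q + 1))) +
        (if 0 < u then 0 else q / (q + 1) * (2 * η - 1))
      ≤ η * loss q u + (1 - η) * loss q (-u) := by
  have hη : 0 < 1 - η := by linarith
  have hy : 1 < η / (1 - η) := by rw [one_lt_div hη]; linarith
  set t := (η / (1 - η)) ^ (1 / (q + 1)) with ht
  have hpc : 1 / (q + 1) = 1 - q / (q + 1) := by field_simp; ring
  split_ifs with hu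
  -- The tangent at s = t, weighted by η, has slope -(1-η), which cancels the slope of the bound
  -- (1-η)(1+u) for the other label.
  · have ht1 : 1 ≤ t := Real.one_le_rpow hy.le (by positivity)
    have ht0 : 0 < t := by linarith
    have e1 : t ^ (-(q + 1)) = (1 - η) / η := by
      rw [ht, ← Real.rpow_mul (by positivity), show 1 / (q + 1) * -(q + 1) = -1 by field_simp,
        Real.rpow_neg_one, inv_div]
    have e2 : t ^ (-q) = t * ((1 - η) / η) := by
      rw [← e1, show -q = 1 + -(q + 1) by ring, Real.rpow_add ht0, Real.rpow_one]
    have h := loss_tangent hq ht1 u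
    rw [e1, e2] at h
    have h2 := mul_le_mul_of_nonneg_left h (show 0 ≤ η by linarith)
    have h3 := mul_le_mul_of_nonneg_left (one_sub_le_loss hq (-u)) hη.le
    have e3 : η * (t * ((1 - η) / η) / (q + 1) - (1 - η) / η * (u - q / (q + 1) * t))
        = (1 - η) * (t * (1 / (q + 1)) - (u - q / (q + 1) * t)) := by
      field_simp
    rw [e3, hpc] at h2
    nlinarith
  -- For u ≤ 0 the bounds 1-u and 1+u give risk at least 1, while Bernoulli's inequality bounds the
  -- minimal risk by 1 - q/(q+1)·(2η-1).
  · have h := rpow_one_add_le_one_add_mul_self (s := η / (1 - η) - 1) (by linarith)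
      (show 0 ≤ 1 / (q + 1) by positivity) (by rw [div_le_one (by positivity)]; linarith)
    rw [add_sub_cancel, ← ht] at h
    have h2 := mul_le_mul_of_nonneg_left h hη.le
    have e : (1 - η) * (1 + 1 / (q + 1) * (η / (1 - η) - 1))
        = (1 - η) + (1 / (q + 1)) * (2 * η - 1) := by
      field_simp
      ring
    rw [e, hpc] at h2
    have h3 := mul_le_mul_of_nonneg_left (one_sub_le_loss hq (-u)) hη.le
    have h4 := mul_le_mul_of_nonneg_left (one_sub_le_loss hq u) (show 0 ≤ η by linarith)
    nlinarith

lemma conditional_risk_optScore (hq : 0 < q) {η : ℝ} (h0 : 1 / 2 < η) (h1 : η < 1) :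
    ENNReal.ofReal η * lossExt q (optScore q η)
        + ENNReal.ofReal (1 - η) * lossExt q (-optScore q η)
      = ENNReal.ofReal ((1 - η) * (1 + (η / (1 - η)) ^ (1 / (q + 1)))) := by
  have hη : 0 < 1 - η := by linarith
  have hy : 1 < η / (1 - η) := by rw [one_lt_div hη]; linarith
  rw [optScore, if_pos h0, if_pos h1]
  set t := (η / (1 - η)) ^ (1 / (q + 1)) with ht
  have hpc : 1 / (q + 1) = 1 - q / (q + 1) := by field_simp; ring
  have ht1 : 1 ≤ t := Real.one_le_rpow hy.le (by positivity)
  have ht0 : 0 < t := by linarith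
  have hct : 0 < q / (q + 1) * t := by positivity
  have hc : 0 < q / (q + 1) := by positivity
  have e2 : t ^ (-q) = t * ((1 - η) / η) := by
    rw [show -q = 1 + -(q + 1) by ring, Real.rpow_add ht0, Real.rpow_one, ht,
      ← Real.rpow_mul (x := η / (1 - η)) (by positivity) (1 / (q + 1)) (-(q + 1)),
      show 1 / (q + 1) * -(q + 1) = -1 by field_simp, Real.rpow_neg_one, inv_div]
  rw [← EReal.coe_neg, lossExt_coe, lossExt_coe, ← ENNReal.ofReal_mul (by linarith),
    ← ENNReal.ofReal_mul hη.le,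
    ← ENNReal.ofReal_add (mul_nonneg (by linarith) (loss_nonneg hq _))
      (mul_nonneg hη.le (loss_nonneg hq _)), loss_scaled hq ht1, loss_of_le (by linarith), e2]
  congr 1
  rw [show η * (t * ((1 - η) / η) / (q + 1)) = (1 - η) * (t * (1 / (q + 1))) by field_simp, hpc]
  ring

lemma calibration_of_half_lt (hq : 0 < q) {η : ℝ} (h0 : 1 / 2 < η) (h1 : η ≤ 1) (u : ℝ) :
    ENNReal.ofReal η * lossExt q (optScore q η)
        + ENNReal.ofReal (1 - η) * lossExt q (-optScore q η)
        + ENNReal.ofReal (if 0 < u then 0 else q / (q + 1) * (2 * η - 1))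
      ≤ ENNReal.ofReal (η * loss q u + (1 - η) * loss q (-u)) := by
  have hif : 0 ≤ if 0 < u then 0 else q / (q + 1) * (2 * η - 1) := by
    split_ifs
    · rfl
    · exact mul_nonneg (by positivity) (by linarith)
  rcases h1.eq_or_lt with rfl | h1
  -- At η = 1 the infinite loss of the absent label has weight 0, and 0 · ∞ = 0.
  · rw [optScore, if_pos h0, if_neg (lt_irrefl _), lossExt_top, sub_self, ENNReal.ofReal_zero,
      zero_mul, mul_zero, zero_add, zero_add]
    apply ENNReal.ofReal_le_ofReal
    have hc : q / (q + 1) ≤ 1 := by rw [div_le_one (by positivity)]; linarith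
    split_ifs with hu
    · linarith [loss_nonneg hq u]
    · linarith [one_sub_le_loss hq u]
  · rw [conditional_risk_optScore hq h0 h1, ← ENNReal.ofReal_add _ hif]
    · exact ENNReal.ofReal_le_ofReal (conditional_risk_bound hq h0 h1 u)
    · have : 0 < 1 - η := by linarith
      positivity

/-- The calibration inequality: the excess conditional `V_q`-risk of a score with the wrong sign
is at least proportional to the classification margin `|2η - 1|`. -/
lemma calibration (hq : 0 < q) {η : ℝ} (h0 : 0 ≤ η) (h1 : η ≤ 1) (u : ℝ) :
    ENNReal.ofReal η * lossExt q (optScore q η)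
        + ENNReal.ofReal (1 - η) * lossExt q (-optScore q η)
        + ENNReal.ofReal
          (if Real.sign u = Real.sign (η - 1 / 2) then 0 else q / (q + 1) * |2 * η - 1|)
      ≤ ENNReal.ofReal (η * loss q u + (1 - η) * loss q (-u)) := by
  rcases lt_trichotomy η (1 / 2) with h | h | h
  · have key := calibration_of_half_lt hq (η := 1 - η) (by linarith) (by linarith) (-u)
    rw [optScore_one_sub, neg_neg, neg_neg, sub_sub_cancel,
      add_comm (ENNReal.ofReal (1 - η) * _), add_comm ((1 - η) * _)] at key
    have e : (if Real.sign u = Real.sign (η - 1 / 2) then 0 else q / (q + 1) * |2 * η - 1|)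
        = if 0 < -u then 0 else q / (q + 1) * (2 * (1 - η) - 1) := by
      rw [Real.sign_of_neg (r := η - 1 / 2) (by linarith), abs_of_neg (by linarith)]
      rcases lt_trichotomy u 0 with hu | rfl | hu
      · rw [Real.sign_of_neg hu, if_pos rfl, if_pos (by linarith)]
      · rw [Real.sign_zero, if_neg (by norm_num), if_neg (by norm_num)]; ring
      · rw [Real.sign_of_pos hu, if_neg (by norm_num), if_neg (by linarith)]; ring
    rw [e]
    exact key
  · subst h
    have e : optScore q (1 / 2) = 0 := by
      rw [optScore, if_neg (lt_irrefl _), if_neg (lt_irrefl _)]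
    have e0 : lossExt q 0 = 1 := by
      rw [← EReal.coe_zero, lossExt_coe, loss_zero hq, ENNReal.ofReal_one]
    rw [e, neg_zero, e0, mul_one, mul_one,
      show (2 : ℝ) * (1 / 2) - 1 = 0 by norm_num, abs_zero, mul_zero, ite_self,
      ENNReal.ofReal_zero, add_zero, ← ENNReal.ofReal_add (by norm_num) (by norm_num)]
    apply ENNReal.ofReal_le_ofReal
    linarith [one_sub_le_loss hq u, one_sub_le_loss hq (-u)]
  · have key := calibration_of_half_lt hq h h1 u
    have e : (if Real.sign u = Real.sign (η - 1 / 2) then 0 else q / (q + 1) * |2 * η - 1|)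
        = if 0 < u then 0 else q / (q + 1) * (2 * η - 1) := by
      rw [Real.sign_of_pos (r := η - 1 / 2) (by linarith), abs_of_pos (by linarith)]
      rcases lt_trichotomy u 0 with hu | rfl | hu
      · rw [Real.sign_of_neg hu, if_neg (by norm_num), if_neg (by linarith)]
      · rw [Real.sign_zero, if_neg (by norm_num), if_neg (by norm_num)]
      · rw [Real.sign_of_pos hu, if_pos rfl, if_pos hu]
    rw [e]
    exact key

end Calibration

end DWD

end

namespace DWD

/-! ### The population risk by conditioning on X -/

section PopulationRisk

variable {X : Type*} [MeasurableSpace X] {q : ℝ}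

lemma measurable_condProb (ρ : Measure (X × ℝ)) [IsFiniteMeasure ρ] :
    Measurable (condProb ρ) :=
  (Kernel.measurable_coe ρ.condKernel (measurableSet_singleton (1 : ℝ))).ennreal_toReal

lemma condProb_nonneg (ρ : Measure (X × ℝ)) [IsFiniteMeasure ρ] (x : X) : 0 ≤ condProb ρ x :=
  measureReal_nonneg

lemma condProb_le_one (ρ : Measure (X × ℝ)) [IsFiniteMeasure ρ] (x : X) : condProb ρ x ≤ 1 :=
  measureReal_le_one

lemma measurable_optScore (q : ℝ) : Measurable (optScore q) := by
  unfold optScore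
  refine Measurable.ite measurableSet_Ioi (Measurable.ite measurableSet_Iio ?_ measurable_const)
    (Measurable.ite measurableSet_Iio (Measurable.ite measurableSet_Ioi ?_ measurable_const)
      measurable_const)
  all_goals exact measurable_coe_real_ereal.comp (by fun_prop)

lemma measurable_popMinimizer (q : ℝ) (ρ : Measure (X × ℝ)) [IsFiniteMeasure ρ] :
    Measurable (popMinimizer q ρ) :=
  (measurable_optScore q).comp (measurable_condProb ρ)

lemma measurable_sign : Measurable Real.sign := by
  unfold Real.sign
  exact Measurable.ite measurableSet_Iio measurable_const
    (Measurable.ite measurableSet_Ioi measurable_const measurable_const)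

lemma measurable_bayesRule (ρ : Measure (X × ℝ)) [IsFiniteMeasure ρ] :
    Measurable (bayesRule ρ) :=
  measurable_sign.comp ((measurable_condProb ρ).sub_const _)

/-- For labels in `{-1, 1}`, integration against the joint law is integration of the conditional
expectation given by the class probability. -/
lemma lintegral_eq_condProb (ρ : Measure (X × ℝ)) [IsFiniteMeasure ρ]
    (hlabel : ∀ᵐ z ∂ρ, z.2 = 1 ∨ z.2 = -1) {F : X × ℝ → ℝ≥0∞} (hF : Measurable F) :
    ∫⁻ z, F z ∂ρ = ∫⁻ x, (ENNReal.ofReal (condProb ρ x) * F (x, 1)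
      + ENNReal.ofReal (1 - condProb ρ x) * F (x, -1)) ∂ρ.fst := by
  rw [← Measure.lintegral_condKernel hF]
  have h := hlabel
  rw [← ρ.disintegrate ρ.condKernel] at h
  refine lintegral_congr_ae ?_
  filter_upwards [Measure.ae_ae_of_ae_compProd h] with x hx
  have hmem : ∀ᵐ y ∂ρ.condKernel x, y ∈ (({1, -1} : Finset ℝ) : Set ℝ) := by
    filter_upwards [hx] with y hy
    simpa using hy
  have hone : ρ.condKernel x {1} + ρ.condKernel x {-1} = 1 := by
    rw [← measure_union (by norm_num) (measurableSet_singleton _), ← prob_compl_eq_zero_iff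
      ((measurableSet_singleton _).union (measurableSet_singleton _))]
    have h0 := ae_iff.1 hx
    convert h0 using 2
    ext y
    simp [and_comm]
  have h1 : ENNReal.ofReal (condProb ρ x) = ρ.condKernel x {1} := ofReal_measureReal
  have h2 : ENNReal.ofReal (1 - condProb ρ x) = ρ.condKernel x {-1} := by
    rw [ENNReal.ofReal_sub _ (condProb_nonneg ρ x), h1, ENNReal.ofReal_one, ← hone]
    exact ENNReal.add_sub_cancel_left (measure_ne_top _ _)
  rw [h1, h2, ← Measure.restrict_eq_self_of_ae_mem hmem, lintegral_finset,
    Finset.sum_pair (by norm_num), Measure.restrict_eq_self_of_ae_mem hmem, mul_comm,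
    mul_comm (F (x, -1))]

lemma measurable_lossExt (hq : 0 < q) : Measurable (lossExt q) :=
  (lossExt_antitone hq).measurable

lemma lossRisk_eq_condProb (hq : 0 < q) (ρ : Measure (X × ℝ)) [IsFiniteMeasure ρ]
    (hlabel : ∀ᵐ z ∂ρ, z.2 = 1 ∨ z.2 = -1) {g : X → EReal} (hg : Measurable g) :
    lossRisk q ρ g = ∫⁻ x, (ENNReal.ofReal (condProb ρ x) * lossExt q (g x)
      + ENNReal.ofReal (1 - condProb ρ x) * lossExt q (-g x)) ∂ρ.fst := by
  -- For labels ±1 the product is ±g, so measurability of a two-branch integrand suffices.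
  have hm : Measurable fun z : X × ℝ =>
      if z.2 = 1 then lossExt q (g z.1) else lossExt q (-g z.1) :=
    Measurable.ite (measurable_snd (measurableSet_singleton _))
      ((measurable_lossExt hq).comp (hg.comp measurable_fst))
      ((measurable_lossExt hq).comp ((hg.comp measurable_fst).neg))
  have e : lossRisk q ρ g
      = ∫⁻ z, (if z.2 = 1 then lossExt q (g z.1) else lossExt q (-g z.1)) ∂ρ := by
    refine lintegral_congr_ae ?_
    filter_upwards [hlabel] with z hz
    rcases hz with hz | hz
    · simp [hz]
    · rw [hz, if_neg (by norm_num)]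
      congr 1
      rw [EReal.coe_neg, EReal.coe_one, neg_mul, one_mul]
  rw [e, lintegral_eq_condProb ρ hlabel hm]
  refine lintegral_congr fun x => ?_
  rw [if_pos rfl, if_neg (by norm_num)]

lemma lossRisk_coe (q : ℝ) (ρ : Measure (X × ℝ)) (f : X → ℝ) :
    lossRisk q ρ (fun x => (f x : EReal)) = ∫⁻ z, ENNReal.ofReal (loss q (z.2 * f z.1)) ∂ρ :=
  lintegral_congr fun z => by rw [← EReal.coe_mul, lossExt_coe]

lemma lossRisk_popMinimizer_add_le (hq : 0 < q) (ρ : Measure (X × ℝ)) [IsFiniteMeasure ρ]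
    (hlabel : ∀ᵐ z ∂ρ, z.2 = 1 ∨ z.2 = -1) {f : X → ℝ} (hf : Measurable f) :
    lossRisk q ρ (popMinimizer q ρ) + ∫⁻ x, ENNReal.ofReal
        (if Real.sign (f x) = bayesRule ρ x then 0
          else q / (q + 1) * |2 * condProb ρ x - 1|) ∂ρ.fst
      ≤ lossRisk q ρ (fun x => (f x : EReal)) := by
  rw [lossRisk_eq_condProb hq ρ hlabel (measurable_popMinimizer q ρ),
    lossRisk_eq_condProb hq ρ hlabel (g := fun x => (f x : EReal))
      (measurable_coe_real_ereal.comp hf), ← lintegral_add_right]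
  · refine lintegral_mono fun x => ?_
    have h := calibration hq (condProb_nonneg ρ x) (condProb_le_one ρ x) (f x)
    refine h.trans (le_of_eq ?_)
    have h1 : 0 ≤ 1 - condProb ρ x := sub_nonneg.2 (condProb_le_one ρ x)
    have h0 := condProb_nonneg ρ x
    rw [← EReal.coe_neg, lossExt_coe, lossExt_coe, ← ENNReal.ofReal_mul h0,
      ← ENNReal.ofReal_mul h1, ENNReal.ofReal_add (mul_nonneg h0 (loss_nonneg hq _))
        (mul_nonneg h1 (loss_nonneg hq _))]
  · refine ENNReal.measurable_ofReal.comp (Measurable.ite ?_ measurable_const ?_)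
    · exact measurableSet_eq_fun (measurable_sign.comp hf) (measurable_bayesRule ρ)
    · exact ((((measurable_condProb ρ).const_mul 2).sub_const 1).abs).const_mul _

lemma lossRisk_popMinimizer_le (hq : 0 < q) (ρ : Measure (X × ℝ)) [IsFiniteMeasure ρ]
    (hlabel : ∀ᵐ z ∂ρ, z.2 = 1 ∨ z.2 = -1) {f : X → ℝ} (hf : Measurable f) :
    lossRisk q ρ (popMinimizer q ρ) ≤ lossRisk q ρ (fun x => (f x : EReal)) :=
  le_self_add.trans (lossRisk_popMinimizer_add_le hq ρ hlabel hf)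

lemma lossRisk_popMinimizer_ne_top (hq : 0 < q) (ρ : Measure (X × ℝ)) [IsFiniteMeasure ρ]
    (hlabel : ∀ᵐ z ∂ρ, z.2 = 1 ∨ z.2 = -1) : lossRisk q ρ (popMinimizer q ρ) ≠ ⊤ := by
  refine ne_top_of_le_ne_top ?_
    (lossRisk_popMinimizer_le hq ρ hlabel (measurable_const (a := (0 : ℝ))))
  rw [lossRisk_coe q ρ fun _ => 0]
  simp [loss_zero hq]

lemma lossRisk_le_add (hq : 0 < q) (ρ : Measure (X × ℝ))
    (hlabel : ∀ᵐ z ∂ρ, z.2 = 1 ∨ z.2 = -1) {f g : X → ℝ} (hf : Measurable f)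
    (hg : Measurable g) :
    lossRisk q ρ (fun x => (f x : EReal))
      ≤ lossRisk q ρ (fun x => (g x : EReal)) + ∫⁻ x, ‖f x - g x‖ₑ ∂ρ.fst := by
  have hm : Measurable fun x => ‖f x - g x‖ₑ := (hf.sub hg).enorm
  rw [lossRisk_coe, lossRisk_coe, Measure.fst, lintegral_map hm measurable_fst,
    ← lintegral_add_right _ (by exact hm.comp measurable_fst)]
  refine lintegral_mono_ae ?_
  filter_upwards [hlabel] with z hz
  rw [← ofReal_norm, ← ENNReal.ofReal_add (loss_nonneg hq _) (norm_nonneg _)]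
  apply ENNReal.ofReal_le_ofReal
  have h := (abs_le.1 (abs_loss_sub_le hq (z.2 * f z.1) (z.2 * g z.1))).2
  have h1 : |z.2 * f z.1 - z.2 * g z.1| = ‖f z.1 - g z.1‖ := by
    rw [← mul_sub, abs_mul, Real.norm_eq_abs]
    rcases hz with hz | hz <;> simp [hz]
  linarith

/-- Clip f̃ to [-M, M] with V_q(M) ≤ ε: clipping from below lowers the loss, and clipping from above
leaves it at most ε. Clipping is odd, so the label -1 is treated in the same way. -/
lemma exists_bounded_lossRisk_le (hq : 0 < q) (ρ : Measure (X × ℝ)) [IsProbabilityMeasure ρ]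
    (hlabel : ∀ᵐ z ∂ρ, z.2 = 1 ∨ z.2 = -1) {ε : ℝ} (hε : 0 < ε) :
    ∃ (M : ℝ) (f : X → ℝ), Measurable f ∧ (∀ x, |f x| ≤ M) ∧
      lossRisk q ρ (fun x => (f x : EReal))
        ≤ lossRisk q ρ (popMinimizer q ρ) + ENNReal.ofReal ε := by
  obtain ⟨M, hM, hMε⟩ := exists_loss_le hq hε
  set T : EReal → EReal := fun v => max (-(M : EReal)) (min v M) with hT
  have hneg : -(M : EReal) ≤ M := by
    rw [← EReal.coe_neg]; exact EReal.coe_le_coe_iff.2 (by linarith)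
  have hcoe : ∀ v, ((T v).toReal : EReal) = T v := by
    intro v
    apply EReal.coe_toReal
    · exact ne_top_of_le_ne_top (EReal.coe_ne_top M) (max_le hneg (min_le_right _ _))
    · exact (lt_of_lt_of_le (by rw [← EReal.coe_neg]; exact EReal.bot_lt_coe _)
        (le_max_left _ _)).ne'
  have hTneg : ∀ v, -T v = T (-v) := by
    intro v
    have hanti : Antitone (fun x : EReal => -x) := fun a b h => EReal.neg_le_neg_iff.2 h
    simp only [hT]
    rw [hanti.map_max (a := -(M : EReal)), hanti.map_min, neg_neg]
    rcases le_total (-v) M with h | h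
    · rw [min_eq_left h, max_comm (-v), min_eq_right (max_le hneg h)]
    · rw [min_eq_right h, max_eq_right hneg, max_eq_left (hneg.trans h), min_eq_left h]
  have hTle : ∀ v, lossExt q (T v) ≤ lossExt q v + ENNReal.ofReal ε := by
    intro v
    rcases le_total v M with h | h
    · refine (lossExt_antitone hq ?_).trans le_self_add
      simp [hT, min_eq_left h]
    · simp only [hT]
      rw [min_eq_right h, max_eq_right hneg, lossExt_coe]
      exact (ENNReal.ofReal_le_ofReal hMε).trans le_add_self
  have hTm : Measurable T := measurable_const.max (measurable_id.min measurable_const)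
  refine ⟨M, fun x => (T (popMinimizer q ρ x)).toReal,
    (hTm.comp (measurable_popMinimizer q ρ)).ereal_toReal, fun x => ?_, ?_⟩
  · rw [abs_le, ← EReal.coe_le_coe_iff, ← EReal.coe_le_coe_iff, hcoe, EReal.coe_neg]
    exact ⟨le_max_left _ _, max_le hneg (min_le_right _ _)⟩
  · simp only [hcoe]
    have hprob : ENNReal.ofReal ε = ∫⁻ _, ENNReal.ofReal ε ∂ρ := by simp
    rw [hprob, lossRisk, lossRisk, ← lintegral_add_right _ measurable_const]
    refine lintegral_mono_ae ?_
    filter_upwards [hlabel] with z hz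
    rcases hz with hz | hz
    · rw [hz, EReal.coe_one, one_mul, one_mul]
      exact hTle _
    · rw [hz, EReal.coe_neg, EReal.coe_one, neg_mul, one_mul, neg_mul, one_mul, hTneg]
      exact hTle _

end PopulationRisk

/-! ### Vanishing of the approximation error -/

section Universal

variable {X : Type*} [MetricSpace X] [MeasurableSpace X] [BorelSpace X]
variable {H : Type*} [NormedAddCommGroup H] [InnerProductSpace ℝ H] [RKHS ℝ H X ℝ] {q : ℝ}

lemma IsUniversal.measurable (hUniv : IsUniversal H) (f : H) : Measurable (f : X → ℝ) :=
  (hUniv.1 f).measurable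

lemma lossRisk_popMinimizer_le_infRisk (hUniv : IsUniversal H) (hq : 0 < q)
    (ρ : Measure (X × ℝ)) [IsFiniteMeasure ρ] (hlabel : ∀ᵐ z ∂ρ, z.2 = 1 ∨ z.2 = -1) :
    lossRisk q ρ (popMinimizer q ρ) ≤ infRisk H q ρ :=
  le_iInf fun f => lossRisk_popMinimizer_le hq ρ hlabel (hUniv.measurable f)

lemma infRisk_eq [CompactSpace X] (hUniv : IsUniversal H) (hq : 0 < q) (ρ : Measure (X × ℝ))
    [IsProbabilityMeasure ρ] (hlabel : ∀ᵐ z ∂ρ, z.2 = 1 ∨ z.2 = -1) :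
    infRisk H q ρ = lossRisk q ρ (popMinimizer q ρ) := by
  refine le_antisymm ?_ (lossRisk_popMinimizer_le_infRisk hUniv hq ρ hlabel)
  refine ENNReal.le_of_forall_pos_le_add fun ε hε _ => ?_
  -- One third each for truncation, L¹ approximation by a continuous function, and uniform
  -- approximation from H.
  have hε3 : (0 : ℝ) < ε / 3 := by positivity
  obtain ⟨M, f, hf, hfM, hfε⟩ := exists_bounded_lossRisk_le hq ρ hlabel hε3
  have hint : Integrable f ρ.fst :=
    Integrable.of_bound hf.aestronglyMeasurable M (ae_of_all _ hfM)
  obtain ⟨g, hg, -⟩ := hint.exists_boundedContinuous_lintegral_sub_le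
    (ε := ENNReal.ofReal (ε / 3)) (by simpa using hε)
  obtain ⟨h, hh⟩ := hUniv.2 g.toContinuousMap (ε / 3) hε3
  have hgm : Measurable g := g.continuous.measurable
  have s1 := lossRisk_le_add hq ρ hlabel (hUniv.measurable h) hgm
  have s2 := lossRisk_le_add hq ρ hlabel hgm hf
  have s3 : ∫⁻ x, ‖h x - g x‖ₑ ∂ρ.fst ≤ ENNReal.ofReal (ε / 3) := by
    refine (lintegral_mono (g := fun _ => ENNReal.ofReal (ε / 3)) fun x => ?_).trans ?_
    · rw [← ofReal_norm]
      exact ENNReal.ofReal_le_ofReal (hh x).le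
    · simp
  have s4 : ∫⁻ x, ‖g x - f x‖ₑ ∂ρ.fst ≤ ENNReal.ofReal (ε / 3) := by
    simpa only [enorm_sub_rev] using hg
  calc infRisk H q ρ ≤ lossRisk q ρ (fun x => (h x : EReal)) := iInf_le _ h
    _ ≤ lossRisk q ρ (popMinimizer q ρ) + ENNReal.ofReal (ε / 3) + ENNReal.ofReal (ε / 3)
        + ENNReal.ofReal (ε / 3) := by
      refine s1.trans (add_le_add (s2.trans (add_le_add hfε s4)) s3)
    _ = lossRisk q ρ (popMinimizer q ρ) + ε := by
      rw [add_assoc, add_assoc, ← ENNReal.ofReal_add hε3.le hε3.le,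
        ← ENNReal.ofReal_add hε3.le (by positivity),
        show (ε : ℝ) / 3 + (ε / 3 + ε / 3) = ε by ring, ENNReal.ofReal_coe_nnreal]

lemma infRisk_ne_top [CompactSpace X] (hUniv : IsUniversal H) (hq : 0 < q) (ρ : Measure (X × ℝ))
    [IsProbabilityMeasure ρ] (hlabel : ∀ᵐ z ∂ρ, z.2 = 1 ∨ z.2 = -1) :
    infRisk H q ρ ≠ ⊤ := by
  rw [infRisk_eq hUniv hq ρ hlabel]
  exact lossRisk_popMinimizer_ne_top hq ρ hlabel

lemma approxError_eq_zero [CompactSpace X] (hUniv : IsUniversal H) (hq : 0 < q) (ρ : Measure (X × ℝ))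
    [IsProbabilityMeasure ρ] (hlabel : ∀ᵐ z ∂ρ, z.2 = 1 ∨ z.2 = -1) :
    approxError H q ρ = 0 := by
  rw [approxError, infRisk_eq hUniv hq ρ hlabel]
  refine EReal.sub_self ?_ (EReal.coe_ennreal_ne_bot _)
  rw [Ne, EReal.coe_ennreal_eq_top_iff]
  exact lossRisk_popMinimizer_ne_top hq ρ hlabel

end Universal

end DWD

noncomputable section

namespace DWD

/-! ### Strong convexity and stability -/

section RegularizedRisk

variable {X : Type*} {H : Type*} [NormedAddCommGroup H] [InnerProductSpace ℝ H] [RKHS ℝ H X ℝ]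
  {q lam : ℝ} {n : ℕ}

lemma regEmpRisk_congr {z z' : ℕ → X × ℝ} (h : ∀ i < n, z i = z' i) (f : H) :
    regEmpRisk q lam n z f = regEmpRisk q lam n z' f := by
  unfold regEmpRisk
  congr 2
  refine Finset.sum_congr rfl fun i hi => ?_
  rw [h i (Finset.mem_range.1 hi)]

lemma continuous_regEmpRisk (hq : 0 < q) (z : ℕ → X × ℝ) :
    Continuous fun f : H => regEmpRisk q lam n z f := by
  unfold regEmpRisk
  refine (continuous_const.mul (continuous_finsetSum _ fun i _ => ?_)).add
    (continuous_const.mul (continuous_norm.pow 2))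
  exact (continuous_loss hq).comp (continuous_const.mul (RKHS.continuous_eval _))

lemma regEmpRisk_nonneg (hq : 0 < q) (hlam : 0 ≤ lam) (z : ℕ → X × ℝ) (f : H) :
    0 ≤ regEmpRisk q lam n z f :=
  add_nonneg (mul_nonneg (by positivity) (Finset.sum_nonneg fun _ _ => loss_nonneg hq _))
    (by positivity)

/-- Midpoint convexity of the loss plus the parallelogram identity for the penalty. -/
lemma regEmpRisk_midpoint_le (hq : 0 < q) (z : ℕ → X × ℝ) (f g : H) :
    regEmpRisk q lam n z ((1 / 2 : ℝ) • (f + g)) ≤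
      (regEmpRisk q lam n z f + regEmpRisk q lam n z g) / 2 - lam / 4 * ‖f - g‖ ^ 2 := by
  have hn : ‖(1 / 2 : ℝ) • (f + g)‖ ^ 2
      = (‖f‖ ^ 2 + ‖g‖ ^ 2) / 2 - ‖f - g‖ ^ 2 / 4 := by
    rw [norm_smul, mul_pow, norm_add_sq_real, norm_sub_sq_real]
    norm_num
    ring
  have hs : ∑ i ∈ Finset.range n, loss q ((z i).2 * ((1 / 2 : ℝ) • (f + g)) (z i).1)
      ≤ (∑ i ∈ Finset.range n, loss q ((z i).2 * f (z i).1)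
        + ∑ i ∈ Finset.range n, loss q ((z i).2 * g (z i).1)) / 2 := by
    rw [← Finset.sum_add_distrib, Finset.sum_div]
    refine Finset.sum_le_sum fun i _ => ?_
    refine le_trans (le_of_eq ?_) (loss_midpoint_le hq _ _)
    congr 1
    simp only [RKHS.coe_smul, RKHS.coe_add, Pi.smul_apply, Pi.add_apply, smul_eq_mul]
    ring
  have h1 := mul_le_mul_of_nonneg_left hs (show 0 ≤ 1 / (n : ℝ) by positivity)
  unfold regEmpRisk
  rw [hn]
  linarith

/-- `f` minimizes the regularized empirical risk up to an error `δ`. -/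
def IsNearKernelDWD (q lam : ℝ) (n : ℕ) (δ : ℝ) (z : ℕ → X × ℝ) (f : H) : Prop :=
  ∀ g : H, regEmpRisk q lam n z f ≤ regEmpRisk q lam n z g + δ

lemma IsKernelDWD.isNearKernelDWD {z : ℕ → X × ℝ} {f : H} (h : IsKernelDWD q lam n z f) :
    IsNearKernelDWD q lam n 0 z f := fun g => by simpa using h g

/-- Quadratic growth, obtained by testing near-minimality against the midpoint of f and g. -/
lemma IsNearKernelDWD.add_norm_sq_le (hq : 0 < q) {δ : ℝ} {z : ℕ → X × ℝ} {f : H}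
    (h : IsNearKernelDWD q lam n δ z f) (g : H) :
    regEmpRisk q lam n z f + lam / 2 * ‖f - g‖ ^ 2 ≤ regEmpRisk q lam n z g + 2 * δ := by
  have h1 := h ((1 / 2 : ℝ) • (f + g))
  have h2 := regEmpRisk_midpoint_le (lam := lam) (n := n) hq z f g
  linarith

lemma IsNearKernelDWD.sum_loss_le (hlam : 0 ≤ lam) (hn : 0 < n) {δ : ℝ} {z : ℕ → X × ℝ} {f : H}
    (h : IsNearKernelDWD q lam n δ z f) (g : H) :
    ∑ i ∈ Finset.range n, loss q ((z i).2 * f (z i).1)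
      ≤ ∑ i ∈ Finset.range n, loss q ((z i).2 * g (z i).1) + n * (lam * ‖g‖ ^ 2 + δ) := by
  have h1 := h g
  unfold regEmpRisk at h1
  have hn' : (0 : ℝ) < n := by exact_mod_cast hn
  have h2 := mul_le_mul_of_nonneg_left h1 hn'.le
  have h3 : 0 ≤ n * (lam * ‖f‖ ^ 2) := by positivity
  rw [mul_add, add_assoc, mul_add, ← mul_assoc, ← mul_assoc, mul_one_div_cancel hn'.ne', one_mul,
    ← mul_assoc (n : ℝ) (1 / (n : ℝ)), mul_one_div_cancel hn'.ne', one_mul] at h2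
  linarith

lemma abs_loss_label_sub_le (hq : 0 < q) {κ : ℝ} (hκ : ∀ (f : H) x, |f x| ≤ κ * ‖f‖)
    {w : X × ℝ} (hw : w.2 = 1 ∨ w.2 = -1) (f g : H) :
    |loss q (w.2 * f w.1) - loss q (w.2 * g w.1)| ≤ κ * ‖f - g‖ := by
  refine (abs_loss_sub_le hq _ _).trans ((le_of_eq ?_).trans (hκ (f - g) w.1))
  rw [← mul_sub, abs_mul, RKHS.coe_sub, Pi.sub_apply]
  rcases hw with hw | hw <;> simp [hw]

/-- Uniform stability: near-minimizers for two samples that differ in one labelled point are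
close in the Hilbert norm. -/
lemma IsNearKernelDWD.norm_sub_le (hq : 0 < q) (hlam : 0 < lam) (hn : 0 < n) {κ : ℝ} (hκ0 : 0 < κ)
    (hκ : ∀ (f : H) x, |f x| ≤ κ * ‖f‖) {δ : ℝ} (hδ : δ ≤ κ ^ 2 / (4 * n ^ 2 * lam))
    {z z' : ℕ → X × ℝ} {i : ℕ} (hi : i < n) (hzz' : ∀ j < n, j ≠ i → z j = z' j)
    (hz : (z i).2 = 1 ∨ (z i).2 = -1) (hz' : (z' i).2 = 1 ∨ (z' i).2 = -1) {f f' : H}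
    (hf : IsNearKernelDWD q lam n δ z f) (hf' : IsNearKernelDWD q lam n δ z' f') :
    ‖f - f'‖ ≤ 3 * (κ / (n * lam)) := by
  have hn' : (0 : ℝ) < n := by exact_mod_cast hn
  have h1 := hf.add_norm_sq_le hq f'
  have h2 := hf'.add_norm_sq_le hq f
  rw [norm_sub_rev] at h2
  have hdiff : ∀ g : H, regEmpRisk q lam n z g - regEmpRisk q lam n z' g
      = 1 / n * (loss q ((z i).2 * g (z i).1) - loss q ((z' i).2 * g (z' i).1)) := by
    intro g
    unfold regEmpRisk
    rw [← Finset.add_sum_erase _ _ (Finset.mem_range.2 hi),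
      ← Finset.add_sum_erase _ (fun j => loss q ((z' j).2 * g (z' j).1)) (Finset.mem_range.2 hi),
      Finset.sum_congr rfl (g := fun j => loss q ((z' j).2 * g (z' j).1)) fun j hj => ?_]
    · ring
    · rw [Finset.mem_erase, Finset.mem_range] at hj
      rw [hzz' j hj.2 hj.1]
  have d1 := hdiff f
  have d2 := hdiff f'
  have l1 := (abs_le.1 (abs_loss_label_sub_le hq hκ hz f f')).1
  have l2 := (abs_le.1 (abs_loss_label_sub_le hq hκ hz' f f')).2
  set t := ‖f - f'‖ with ht
  have ht0 : 0 ≤ t := norm_nonneg _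
  set a := κ / (n * lam) with ha
  have ha0 : 0 < a := by positivity
  -- Adding the two growth inequalities cancels every loss term except those at index i.
  have hmain : lam * t ^ 2 ≤ 4 * δ + 1 / n * (2 * (κ * t)) := by
    have h3 : 1 / (n : ℝ) * (loss q ((z i).2 * f' (z i).1) - loss q ((z' i).2 * f' (z' i).1))
        - 1 / n * (loss q ((z i).2 * f (z i).1) - loss q ((z' i).2 * f (z' i).1))
        ≤ 1 / n * (2 * (κ * t)) := by
      rw [← mul_sub]
      exact mul_le_mul_of_nonneg_left (by linarith) (by positivity)
    linarith
  have e1 : 1 / (n : ℝ) * (2 * (κ * t)) = lam * (2 * a * t) := by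
    rw [ha]; field_simp
  have e2 : κ ^ 2 / (4 * n ^ 2 * lam) = lam * (a ^ 2 / 4) := by
    rw [ha]; field_simp
  rw [e2] at hδ
  rw [e1] at hmain
  -- This gives t ≤ (1+√2)a, rounded up to 3a.
  have h4 : t ^ 2 ≤ a ^ 2 + 2 * a * t := by
    refine le_of_mul_le_mul_left ?_ hlam
    linarith
  nlinarith

lemma IsNearKernelDWD.norm_sub_le_of_isKernelDWD (hq : 0 < q) (hlam : 0 < lam) (hn : 0 < n)
    {κ : ℝ} (hκ0 : 0 < κ) {δ : ℝ} (hδ : δ ≤ κ ^ 2 / (4 * n ^ 2 * lam)) {z : ℕ → X × ℝ} {f g : H}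
    (hf : IsNearKernelDWD q lam n δ z f) (hg : IsKernelDWD q lam n z g) :
    ‖g - f‖ ≤ κ / (n * lam) := by
  have hn' : (0 : ℝ) < n := by exact_mod_cast hn
  have h1 := hg.isNearKernelDWD.add_norm_sq_le hq f
  have h2 := hf g
  set t := ‖g - f‖ with ht
  have ht0 : 0 ≤ t := norm_nonneg _
  set a := κ / (n * lam) with ha
  have ha0 : 0 < a := by positivity
  have e2 : κ ^ 2 / (4 * n ^ 2 * lam) = lam * (a ^ 2 / 4) := by
    rw [ha]; field_simp
  rw [e2] at hδ
  have h4 : t ^ 2 ≤ a ^ 2 := by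
    refine le_of_mul_le_mul_left ?_ (half_pos hlam)
    nlinarith [mul_pos hlam (pow_pos ha0 2)]
  nlinarith

end RegularizedRisk

/-! ### Measurable selection of a near-minimizer -/

section Selection

/-- The first index at which the sequence `a` is within `δ` of its infimum. -/
def nearArgmin (δ : ℝ) (a : ℕ → ℝ) : ℕ := sInf {k | a k ≤ (⨅ j, a j) + δ}

/-- No lower bound on `a` is needed: if every term exceeded the right side, that value would itself
be a lower bound. -/
lemma exists_le_iInf_add {δ : ℝ} (hδ : 0 < δ) (a : ℕ → ℝ) : ∃ k, a k ≤ (⨅ j, a j) + δ :=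
  (exists_lt_of_ciInf_lt (lt_add_of_pos_right (⨅ j, a j) hδ)).imp fun _ h => h.le

lemma nearArgmin_spec {δ : ℝ} (hδ : 0 < δ) (a : ℕ → ℝ) :
    a (nearArgmin δ a) ≤ (⨅ j, a j) + δ :=
  Nat.sInf_mem (exists_le_iInf_add hδ a)

lemma measurable_nearArgmin {δ : ℝ} (hδ : 0 < δ) : Measurable (nearArgmin δ) := by
  classical
  have e : nearArgmin δ = fun a => Nat.find (exists_le_iInf_add hδ a) := by
    funext a
    exact Nat.sInf_def (exists_le_iInf_add hδ a)
  rw [e]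
  refine measurable_find (exists_le_iInf_add hδ) fun k => ?_
  exact measurableSet_le (measurable_pi_apply k)
    ((Measurable.iInf fun j => measurable_pi_apply j).add_const δ)

variable {X : Type*} {H : Type*} [NormedAddCommGroup H] [InnerProductSpace ℝ H] [RKHS ℝ H X ℝ]
  {q lam : ℝ} {n : ℕ}

/-- The index of an approximate solution of the kernel DWD problem within the sequence `d`. -/
def selIndex (q lam : ℝ) (n : ℕ) (δ : ℝ) (d : ℕ → H) (z : ℕ → X × ℝ) : ℕ :=
  nearArgmin δ fun k => regEmpRisk q lam n z (d k)

lemma selIndex_congr {δ : ℝ} {d : ℕ → H} {z z' : ℕ → X × ℝ} (h : ∀ i < n, z i = z' i) :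
    selIndex q lam n δ d z = selIndex q lam n δ d z' := by
  unfold selIndex
  simp only [regEmpRisk_congr h]

/-- By continuity of the objective, its infimum over a dense sequence bounds it below on all of H.
-/
lemma isNearKernelDWD_selIndex (hq : 0 < q) (hlam : 0 ≤ lam) {δ : ℝ} (hδ : 0 < δ) {d : ℕ → H}
    (hd : DenseRange d) (z : ℕ → X × ℝ) :
    IsNearKernelDWD q lam n δ z (d (selIndex q lam n δ d z)) := by
  intro g
  refine (nearArgmin_spec hδ fun k => regEmpRisk q lam n z (d k)).trans ?_
  gcongr
  refine hd.induction_on (p := fun g => ⨅ j, regEmpRisk q lam n z (d j) ≤ regEmpRisk q lam n z g)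
    g (isClosed_le continuous_const (continuous_regEmpRisk hq z)) fun k => ?_
  exact ciInf_le ⟨0, by rintro _ ⟨j, rfl⟩; exact regEmpRisk_nonneg hq hlam z _⟩ k

lemma measurable_loss_label [MeasurableSpace X] (hq : 0 < q) {f : X → ℝ} (hf : Measurable f) :
    Measurable fun w : X × ℝ => loss q (w.2 * f w.1) :=
  (continuous_loss hq).measurable.comp (measurable_snd.mul (hf.comp measurable_fst))

lemma measurable_selIndex [MeasurableSpace X] (hq : 0 < q)
    (hmeas : ∀ f : H, Measurable (f : X → ℝ)) {δ : ℝ} (hδ : 0 < δ) (d : ℕ → H) :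
    Measurable (selIndex (X := X) q lam n δ d) := by
  refine (measurable_nearArgmin hδ).comp (measurable_pi_lambda _ fun k => ?_)
  unfold regEmpRisk
  refine Measurable.add_const (Measurable.const_mul (Finset.measurable_fun_sum _ fun i _ => ?_) _) _
  exact (measurable_loss_label hq (hmeas (d k))).comp (measurable_pi_apply i)

end Selection

/-! ### Separability of H and the evaluation bound -/

section Separable

variable {X : Type*} {H : Type*} [NormedAddCommGroup H] [InnerProductSpace ℝ H] [CompleteSpace H]
  [RKHS ℝ H X ℝ]

/-- A reproducing kernel Hilbert space of continuous functions on a separable space is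
separable. -/
lemma separableSpace_of_continuous [TopologicalSpace X] [TopologicalSpace.SeparableSpace X]
    (hcont : ∀ f : H, Continuous (f : X → ℝ)) :
    TopologicalSpace.SeparableSpace H := by
  obtain ⟨D, hDc, hDd⟩ := TopologicalSpace.exists_countable_dense X
  set S : Set H := (fun x => RKHS.kerFun H x (1 : ℝ)) '' D with hS
  -- A function orthogonal to the kernel sections at D vanishes on D, hence everywhere by
  -- continuity.
  have htop : (Submodule.span ℝ S).topologicalClosure = ⊤ := by
    refine (Submodule.orthogonal_eq_bot_iff).1 ((Submodule.eq_bot_iff _).2 fun f hf => ?_)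
    rw [Submodule.mem_orthogonal] at hf
    have h0 : (f : X → ℝ) = (0 : H) := by
      refine Continuous.ext_on hDd (hcont f) (hcont 0) fun x hx => ?_
      have h := hf _ (Submodule.le_topologicalClosure _
        (Submodule.subset_span (Set.mem_image_of_mem _ hx)))
      rw [RKHS.kerFun_inner] at h
      simpa using h
    exact DFunLike.coe_injective h0
  rw [← TopologicalSpace.isSeparable_univ_iff, ← Submodule.top_coe (R := ℝ), ← htop,
    Submodule.topologicalClosure_coe]
  exact ((hDc.image _).isSeparable.span).closure

lemma exists_abs_apply_le {K : X → X → ℝ} (hK : IsRKHSOf H K)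
    (hB : BddAbove (Set.range fun x => K x x)) :
    ∃ κ : ℝ, 0 < κ ∧ ∀ (f : H) x, |f x| ≤ κ * ‖f‖ := by
  obtain ⟨B, hB⟩ := hB
  -- The added 1 keeps κ positive when B = 0.
  refine ⟨√B + 1, by positivity, fun f x => ?_⟩
  have h1 : inner ℝ (RKHS.kerFun H x (1 : ℝ)) f = f x := by
    rw [RKHS.kerFun_inner]; simp
  have h2 : ‖RKHS.kerFun H x (1 : ℝ)‖ ≤ √B := by
    apply Real.le_sqrt_of_sq_le
    rw [← real_inner_self_eq_norm_sq, RKHS.kerFun_inner, RKHS.kerFun_apply, hK]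
    simpa using hB ⟨x, rfl⟩
  rw [← h1]
  refine (abs_real_inner_le_norm _ _).trans (mul_le_mul_of_nonneg_right ?_ (norm_nonneg _))
  linarith

end Separable

end DWD

end

namespace DWD

/-! ### Exchangeability and independence of the i.i.d. sample -/

section Sample

lemma map_eq_infinitePi {E : Type*} [MeasurableSpace E] (ρ : Measure E) {Ω : Type*} [MeasurableSpace Ω] {P : Measure Ω} [IsProbabilityMeasure P]
    {Z : ℕ → Ω → E} (hlaw : ∀ i, HasLaw (Z i) ρ P) (hindep : iIndepFun Z P) :
    P.map (fun ω i => Z i ω) = Measure.infinitePi (fun _ : ℕ => ρ) := by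
  rw [(iIndepFun_iff_map_fun_eq_infinitePi_map₀' fun i => (hlaw i).aemeasurable).1 hindep]
  simp only [(hlaw _).map_eq]

variable {E : Type*} [MeasurableSpace E] (ρ : Measure E) [IsProbabilityMeasure ρ]

lemma lintegral_comp_perm (σ : Equiv.Perm ℕ) {G : (ℕ → E) → ℝ≥0∞} (hG : Measurable G) :
    ∫⁻ z, G (fun i => z (σ i)) ∂Measure.infinitePi (fun _ : ℕ => ρ)
      = ∫⁻ z, G z ∂Measure.infinitePi (fun _ : ℕ => ρ) := by
  have hm : Measurable fun (z : ℕ → E) i => z (σ i) := by fun_prop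
  rw [← lintegral_map hG hm,
    Measure.map_infinitePi_infinitePi_of_inj (P := fun _ : ℕ => ρ) σ.injective]

/-- A statistic of the first `n` sample points is independent of the next one. -/
lemma lintegral_fresh {n : ℕ} {N : (ℕ → E) → ℕ} (hN : Measurable N)
    (hNn : ∀ z z' : ℕ → E, (∀ i < n, z i = z' i) → N z = N z') {F : ℕ → E → ℝ≥0∞}
    (hF : ∀ k, Measurable (F k)) :
    ∫⁻ z, F (N z) (z n) ∂Measure.infinitePi (fun _ : ℕ => ρ)
      = ∫⁻ z, ∫⁻ w, F (N z) w ∂ρ ∂Measure.infinitePi (fun _ : ℕ => ρ) := by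
  set Q := Measure.infinitePi (fun _ : ℕ => ρ) with hQ
  obtain ⟨e⟩ : Nonempty E := nonempty_of_isProbabilityMeasure ρ
  have hind : iIndepFun (fun (i : ℕ) (z : ℕ → E) => z i) Q :=
    iIndepFun_infinitePi (X := fun _ w => w) fun _ => measurable_id
  have h1 := hind.indepFun_finset (Finset.range n) {n} (by simp) fun i => measurable_pi_apply i
  -- Padding a finite tuple with `e` exhibits `N` as a function of the first n coordinates alone.
  have hext : Measurable fun (u : Finset.range n → E) (i : ℕ) =>
      if h : i ∈ Finset.range n then u ⟨i, h⟩ else e := by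
    refine measurable_pi_lambda _ fun i => ?_
    by_cases h : i ∈ Finset.range n
    · simp only [h, dite_true]; exact measurable_pi_apply _
    · simp only [h, dite_false]; exact measurable_const
  have h2 := h1.comp (hN.comp hext)
    (measurable_pi_apply (⟨n, Finset.mem_singleton_self n⟩ : ({n} : Finset ℕ)))
  have h3 : IndepFun N (fun z : ℕ → E => z n) Q := by
    convert h2 using 1
    · funext z
      refine hNn _ _ fun i hi => ?_
      simp [hi]
    · rfl
  have hn : Measurable fun z : ℕ → E => z n := measurable_pi_apply n
  have h4 := (indepFun_iff_map_prod_eq_prod_map_map hN.aemeasurable hn.aemeasurable).1 h3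
  have h5 : Q.map (fun z : ℕ → E => z n) = ρ := Measure.infinitePi_map_eval _ n
  have hFm : Measurable fun p : ℕ × E => F p.1 p.2 := measurable_from_prod_countable_right hF
  calc ∫⁻ z, F (N z) (z n) ∂Q = ∫⁻ p, F p.1 p.2 ∂(Q.map fun z => (N z, z n)) :=
        (lintegral_map hFm (hN.prodMk hn)).symm
    _ = ∫⁻ k, ∫⁻ w, F k w ∂ρ ∂(Q.map N) := by
        rw [h4, h5, lintegral_prod _ hFm.aemeasurable]
    _ = ∫⁻ z, ∫⁻ w, F (N z) w ∂ρ ∂Q := lintegral_map (measurable_from_nat) hN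

lemma lintegral_eval (i : ℕ) {G : E → ℝ≥0∞} (hG : Measurable G) :
    ∫⁻ z, G (z i) ∂Measure.infinitePi (fun _ : ℕ => ρ) = ∫⁻ w, G w ∂ρ :=
  (measurePreserving_eval_infinitePi (fun _ : ℕ => ρ) i).lintegral_comp hG

end Sample

/-! ### Expected risk via stability -/

section ExpectedRisk

variable {X : Type*} [MeasurableSpace X] {H : Type*} [NormedAddCommGroup H]
  [InnerProductSpace ℝ H] [RKHS ℝ H X ℝ] {q lam κ : ℝ} {n : ℕ}

lemma lintegral_lossRisk_le (hq : 0 < q) (hlam : 0 < lam) (hn : 0 < n) (hκ0 : 0 < κ)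
    (hκ : ∀ (f : H) x, |f x| ≤ κ * ‖f‖) (hmeas : ∀ f : H, Measurable (f : X → ℝ))
    (ρ : Measure (X × ℝ)) [IsProbabilityMeasure ρ] (hlabel : ∀ᵐ z ∂ρ, z.2 = 1 ∨ z.2 = -1)
    {δ : ℝ} (hδ0 : 0 < δ) (hδ : δ ≤ κ ^ 2 / (4 * n ^ 2 * lam)) {d : ℕ → H} (hd : DenseRange d)
    (f : H) :
    ∫⁻ z, lossRisk q ρ (fun x => (d (selIndex q lam n δ d z) x : EReal))
        ∂Measure.infinitePi (fun _ : ℕ => ρ)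
      ≤ lossRisk q ρ (fun x => (f x : EReal))
        + ENNReal.ofReal (lam * ‖f‖ ^ 2 + 4 * κ ^ 2 / (n * lam)) := by
  set Q := Measure.infinitePi (fun _ : ℕ => ρ) with hQ
  set N : (ℕ → X × ℝ) → ℕ := selIndex q lam n δ d with hNdef
  have hn' : (0 : ℝ) < n := by exact_mod_cast hn
  have hN : Measurable N := measurable_selIndex hq hmeas hδ0 d
  have hnear : ∀ z, IsNearKernelDWD q lam n δ z (d (N z)) :=
    isNearKernelDWD_selIndex hq hlam.le hδ0 hd
  set β : ℝ := 3 * κ ^ 2 / (n * lam) with hβ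
  have hβ0 : 0 ≤ β := by positivity
  have hlm : ∀ g : H, Measurable fun w : X × ℝ => ENNReal.ofReal (loss q (w.2 * g w.1)) :=
    fun g => (measurable_loss_label hq (hmeas g)).ennreal_ofReal
  have hFm : Measurable fun p : ℕ × (X × ℝ) =>
      ENNReal.ofReal (loss q (p.2.2 * d p.1 p.2.1)) :=
    measurable_from_prod_countable_right fun k => hlm (d k)
  have hGm : ∀ i : ℕ, Measurable fun z : ℕ → X × ℝ =>
      ENNReal.ofReal (loss q ((z i).2 * d (N z) (z i).1)) := fun i =>
    hFm.comp (hN.prodMk (measurable_pi_apply i))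
  have hlab : ∀ i : ℕ, ∀ᵐ z ∂Q, (z i).2 = 1 ∨ (z i).2 = -1 := fun i =>
    (measurePreserving_eval_infinitePi (fun _ : ℕ => ρ) i).quasiMeasurePreserving.ae hlabel
  -- Training uses indices 0, …, n-1, so coordinate n is a fresh point.
  have hrisk : ∫⁻ z, lossRisk q ρ (fun x => (d (N z) x : EReal)) ∂Q
      = ∫⁻ z, ENNReal.ofReal (loss q ((z n).2 * d (N z) (z n).1)) ∂Q := by
    rw [hQ, lintegral_fresh ρ hN (fun z z' h => selIndex_congr h) (fun k => hlm (d k)) (n := n)]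
    exact lintegral_congr fun z => lossRisk_coe q ρ _
  have hswap : ∀ i ∈ Finset.range n,
      ∫⁻ z, lossRisk q ρ (fun x => (d (N z) x : EReal)) ∂Q
        ≤ ∫⁻ z, ENNReal.ofReal (loss q ((z i).2 * d (N z) (z i).1)) ∂Q + ENNReal.ofReal β := by
    intro i hi
    have hin := Finset.mem_range.1 hi
    -- Swapping i and n preserves the law and makes `z i` the test point; the swapped training
    -- sample differs from the original only at i, so stability applies.
    rw [hrisk, hQ, ← lintegral_comp_perm ρ (Equiv.swap i n) (hGm n), ← hQ]
    have hc : ENNReal.ofReal β = ∫⁻ _, ENNReal.ofReal β ∂Q := by simp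
    rw [hc, ← lintegral_add_right _ measurable_const]
    refine lintegral_mono_ae ?_
    filter_upwards [hlab i, hlab n] with z hzi hzn
    rw [Equiv.swap_apply_right, ← ENNReal.ofReal_add (loss_nonneg hq _) hβ0]
    apply ENNReal.ofReal_le_ofReal
    have hst := (hnear fun j => z (Equiv.swap i n j)).norm_sub_le hq hlam hn hκ0 hκ hδ hin
      (fun j hj hji => by rw [Equiv.swap_apply_of_ne_of_ne hji hj.ne])
      (by rwa [Equiv.swap_apply_left]) hzi (hnear z)
    have h1 := (abs_le.1 (abs_loss_label_sub_le hq hκ hzi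
      (d (N fun j => z (Equiv.swap i n j))) (d (N z)))).2
    have h2 := mul_le_mul_of_nonneg_left hst hκ0.le
    have h3 : κ * (3 * (κ / (n * lam))) = β := by rw [hβ]; ring
    linarith
  have hsum := Finset.sum_le_sum hswap
  rw [Finset.sum_add_distrib, ← lintegral_finsetSum _ fun i _ => hGm i, Finset.sum_const,
    Finset.sum_const, Finset.card_range, nsmul_eq_mul, nsmul_eq_mul] at hsum
  have hfm : ∀ i : ℕ, Measurable fun z : ℕ → X × ℝ =>
      ENNReal.ofReal (loss q ((z i).2 * f (z i).1)) := fun i =>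
    (hlm f).comp (measurable_pi_apply i)
  have hfit : ∫⁻ z, ∑ i ∈ Finset.range n,
        ENNReal.ofReal (loss q ((z i).2 * d (N z) (z i).1)) ∂Q
      ≤ n * lossRisk q ρ (fun x => (f x : EReal))
        + n * ENNReal.ofReal (lam * ‖f‖ ^ 2 + δ) := by
    calc _ ≤ ∫⁻ z, (∑ i ∈ Finset.range n, ENNReal.ofReal (loss q ((z i).2 * f (z i).1))
          + n * ENNReal.ofReal (lam * ‖f‖ ^ 2 + δ)) ∂Q := by
          refine lintegral_mono fun z => ?_
          rw [← ENNReal.ofReal_sum_of_nonneg fun _ _ => loss_nonneg hq _,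
            ← ENNReal.ofReal_sum_of_nonneg fun _ _ => loss_nonneg hq _, ← ENNReal.ofReal_natCast,
            ← ENNReal.ofReal_mul hn'.le, ← ENNReal.ofReal_add
              (Finset.sum_nonneg fun _ _ => loss_nonneg hq _) (by positivity)]
          exact ENNReal.ofReal_le_ofReal ((hnear z).sum_loss_le hlam.le hn f)
      _ = _ := by
          rw [lintegral_add_right _ measurable_const, lintegral_finsetSum _ fun i _ => hfm i]
          have : ∀ i ∈ Finset.range n, ∫⁻ z, ENNReal.ofReal (loss q ((z i).2 * f (z i).1)) ∂Q
              = lossRisk q ρ (fun x => (f x : EReal)) := fun i _ => by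
            rw [lossRisk_coe]
            exact lintegral_eval ρ i (hlm f)
          rw [Finset.sum_congr rfl this]
          simp
  -- Three units of κ²/(nλ) come from stability, and at most one from the slack δ.
  have hδ' : δ + β ≤ 4 * κ ^ 2 / (n * lam) := by
    have h1 : κ ^ 2 / (4 * n ^ 2 * lam) ≤ κ ^ 2 / (n * lam) := by
      have : (1 : ℝ) ≤ n := by exact_mod_cast hn
      gcongr
      nlinarith
    have h2 : 4 * κ ^ 2 / (n * lam) = κ ^ 2 / (n * lam) + β := by rw [hβ]; ring
    linarith
  have hfin := hsum.trans (add_le_add_left hfit _)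
  rw [← mul_add, ← mul_add] at hfin
  have hcancel := (ENNReal.mul_le_mul_iff_right (by simpa using hn.ne')
    (ENNReal.natCast_ne_top n)).1 hfin
  refine hcancel.trans ?_
  rw [add_assoc, ← ENNReal.ofReal_add (by positivity) hβ0]
  exact add_le_add_right (ENNReal.ofReal_le_ofReal (by linarith)) _

end ExpectedRisk

/-! ### Convergence of the risk in probability -/

section Consistency

lemma lt_estError_iff {X : Type*} [MeasurableSpace X] {H : Type*} [NormedAddCommGroup H]
    [InnerProductSpace ℝ H] [RKHS ℝ H X ℝ] {q : ℝ} {ρ : Measure (X × ℝ)} {f : H} (hfin : infRisk H q ρ ≠ ⊤) {ε : ℝ}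
    (hε : 0 < ε) : (ε : EReal) < estError q ρ f ↔
      infRisk H q ρ + ENNReal.ofReal ε < lossRisk q ρ (fun x => (f x : EReal)) := by
  rw [estError, EReal.lt_sub_iff_add_lt (Or.inl (EReal.coe_ennreal_ne_bot _))
    (Or.inl (by simpa using hfin)), ← EReal.coe_ennreal_lt_coe_ennreal_iff,
    EReal.coe_ennreal_add, EReal.coe_ennreal_ofReal, max_eq_left hε.le, add_comm]

variable {X : Type*} [MetricSpace X] [CompactSpace X] [MeasurableSpace X] [BorelSpace X]
  {H : Type*} [NormedAddCommGroup H] [InnerProductSpace ℝ H] [CompleteSpace H] [RKHS ℝ H X ℝ]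
  {q κ : ℝ}

/-- The `V_q`-risk of kernel DWD converges in (outer) probability to the infimum over `H`. -/
theorem tendsto_measure_infRisk_add_lt_lossRisk (hUniv : IsUniversal H) (hq : 0 < q)
    (hκ0 : 0 < κ) (hκ : ∀ (f : H) x, |f x| ≤ κ * ‖f‖)
    (ρ : Measure (X × ℝ)) [IsProbabilityMeasure ρ] (hlabel : ∀ᵐ z ∂ρ, z.2 = 1 ∨ z.2 = -1)
    {Ω : Type*} [MeasurableSpace Ω] (P : Measure Ω) [IsProbabilityMeasure P]
    (Z : ℕ → Ω → X × ℝ) (hlaw : ∀ i, HasLaw (Z i) ρ P) (hindep : iIndepFun Z P)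
    (lam : ℕ → ℝ) (fhat : ℕ → Ω → H)
    (hfhat : ∀ n, 1 ≤ n → ∀ ω, IsKernelDWD q (lam n) n (fun i => Z i ω) (fhat n ω))
    (hlam0 : Tendsto lam atTop (𝓝 0))
    (hlam : Tendsto (fun n : ℕ => (n : ℝ) * lam n) atTop atTop) {ε : ℝ} (hε : 0 < ε) :
    Tendsto (fun n => P {ω | infRisk H q ρ + ENNReal.ofReal ε
      < lossRisk q ρ (fun x => (fhat n ω x : EReal))}) atTop (𝓝 0) := by
  have := separableSpace_of_continuous hUniv.1
  set d := TopologicalSpace.denseSeq H with hd'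
  have hd : DenseRange d := TopologicalSpace.denseRange_denseSeq H
  have hmeas : ∀ f : H, Measurable (f : X → ℝ) := hUniv.measurable
  have hfin := infRisk_ne_top hUniv hq ρ hlabel
  rw [ENNReal.tendsto_nhds_zero]
  intro η' hη'
  set η := (min η' 1).toReal with hη
  have hmin : min η' 1 ≠ ⊤ := ne_top_of_le_ne_top ENNReal.one_ne_top (min_le_right _ _)
  have hη0 : 0 < η := ENNReal.toReal_pos (lt_min hη' one_pos).ne' hmin
  have hηle : ENNReal.ofReal η ≤ η' := by
    rw [hη, ENNReal.ofReal_toReal hmin]; exact min_le_left _ _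
  -- One quarter pays for the choice of f, fixed before n, and one for the error bound; their sum
  -- ε/2·η gives probability η by Markov at level ε/2.
  have hs : 0 < ε * η / 4 := by positivity
  obtain ⟨f, hf⟩ : ∃ f : H, lossRisk q ρ (fun x => (f x : EReal))
      < infRisk H q ρ + ENNReal.ofReal (ε * η / 4) :=
    iInf_lt_iff.1 (ENNReal.lt_add_right hfin (by simpa using hs))
  have hinv : Tendsto (fun n : ℕ => ((n : ℝ) * lam n)⁻¹) atTop (𝓝 0) :=
    tendsto_inv_atTop_zero.comp hlam
  have hlim1 : Tendsto (fun n : ℕ => lam n * ‖f‖ ^ 2 + 4 * κ ^ 2 / (n * lam n)) atTop (𝓝 0) := by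
    simpa [div_eq_mul_inv] using (hlam0.mul_const (‖f‖ ^ 2)).add (hinv.const_mul (4 * κ ^ 2))
  have hlim2 : Tendsto (fun n : ℕ => κ * (κ / (n * lam n))) atTop (𝓝 0) := by
    simpa [div_eq_mul_inv] using (hinv.const_mul κ).const_mul κ
  filter_upwards [hlam.eventually_gt_atTop 0, eventually_ge_atTop 1,
    hlim1.eventually (gt_mem_nhds hs), hlim2.eventually (gt_mem_nhds (half_pos hε))]
    with n hnl hn1 hb1 hb2
  have hn' : (0 : ℝ) < n := by exact_mod_cast hn1
  have hl : 0 < lam n := pos_of_mul_pos_right hnl hn'.le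
  set δ : ℝ := κ ^ 2 / (4 * n ^ 2 * lam n) with hδ
  have hδ0 : 0 < δ := by positivity
  set N : (ℕ → X × ℝ) → ℕ := selIndex q (lam n) n δ d with hNdef
  have hN : Measurable N := measurable_selIndex hq hmeas hδ0 d
  have hRm : Measurable fun z => lossRisk q ρ (fun x => (d (N z) x : EReal)) :=
    (measurable_from_nat (f := fun k => lossRisk q ρ (fun x => (d k x : EReal)))).comp hN
  have hexp := lintegral_lossRisk_le hq hl hn1 hκ0 hκ hmeas ρ hlabel hδ0 le_rfl hd f
  set A : Set (ℕ → X × ℝ) := {z | infRisk H q ρ + ENNReal.ofReal (ε / 2)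
    ≤ lossRisk q ρ (fun x => (d (N z) x : EReal))} with hA
  have hAm : MeasurableSet A := measurableSet_le measurable_const hRm
  have hmarkov := lintegral_add_mul_meas_add_le_le_lintegral
    (μ := Measure.infinitePi (fun _ : ℕ => ρ)) (f := fun _ => infRisk H q ρ)
    (ae_of_all _ fun z => iInf_le (fun f : H => lossRisk q ρ (fun x => (f x : EReal))) (d (N z)))
    hRm.aemeasurable (ENNReal.ofReal (ε / 2))
  rw [lintegral_const, measure_univ, mul_one] at hmarkov
  have hQA : Measure.infinitePi (fun _ : ℕ => ρ) A ≤ ENNReal.ofReal η := by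
    have h1 := (hmarkov.trans hexp).trans (add_le_add hf.le (ENNReal.ofReal_le_ofReal hb1.le))
    rw [add_assoc, ← ENNReal.ofReal_add hs.le hs.le] at h1
    have h2 := (ENNReal.add_le_add_iff_left hfin).1 h1
    rw [show ε * η / 4 + ε * η / 4 = ε / 2 * η by ring, ENNReal.ofReal_mul (by positivity)] at h2
    exact (ENNReal.mul_le_mul_iff_right (by simpa using hε) ENNReal.ofReal_ne_top).1 h2
  -- The sup distance from f̂_n to the selected function is at most κ·κ/(nλ) < ε/2, so the possibly
  -- nonmeasurable event lies in a measurable one.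
  have hsub : {ω | infRisk H q ρ + ENNReal.ofReal ε
      < lossRisk q ρ (fun x => (fhat n ω x : EReal))} ⊆ (fun ω i => Z i ω) ⁻¹' A := by
    intro ω hω
    have hdist := (isNearKernelDWD_selIndex hq hl.le hδ0 hd
      (fun i => Z i ω)).norm_sub_le_of_isKernelDWD hq hl hn1 hκ0 le_rfl (hfhat n hn1 ω)
    have h1 := lossRisk_le_add hq ρ hlabel (hmeas (fhat n ω)) (hmeas (d (N fun i => Z i ω)))
    have h2 : ∫⁻ x, ‖fhat n ω x - d (N fun i => Z i ω) x‖ₑ ∂ρ.fst ≤ ENNReal.ofReal (ε / 2) := by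
      refine (lintegral_mono (g := fun _ => ENNReal.ofReal (ε / 2)) fun x => ?_).trans ?_
      · rw [← ofReal_norm]
        apply ENNReal.ofReal_le_ofReal
        have h3 := hκ (fhat n ω - d (N fun i => Z i ω)) x
        rw [RKHS.coe_sub, Pi.sub_apply] at h3
        exact h3.trans ((mul_le_mul_of_nonneg_left hdist hκ0.le).trans hb2.le)
      · simp
    have h3 := hω.le.trans (h1.trans (add_le_add_right h2 _))
    have h4 : ENNReal.ofReal ε = ENNReal.ofReal (ε / 2) + ENNReal.ofReal (ε / 2) := by
      rw [← ENNReal.ofReal_add (half_pos hε).le (half_pos hε).le, add_halves]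
    rw [h4, ← add_assoc] at h3
    exact (ENNReal.add_le_add_iff_right ENNReal.ofReal_ne_top).1 h3
  calc _ ≤ P ((fun ω i => Z i ω) ⁻¹' A) := measure_mono hsub
    _ = Measure.infinitePi (fun _ : ℕ => ρ) A := by
      rw [← map_eq_infinitePi ρ hlaw hindep, Measure.map_apply_of_aemeasurable
        (aemeasurable_pi_iff.2 fun i => (hlaw i).aemeasurable) hAm]
    _ ≤ η' := hQA.trans hηle

end Consistency

/-! ### From excess risk to misclassification error -/

section Misclassification

variable {X : Type*} [MeasurableSpace X] {q : ℝ}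

lemma sign_bayesRule (ρ : Measure (X × ℝ)) [IsFiniteMeasure ρ] (x : X) :
    Real.sign (bayesRule ρ x) = bayesRule ρ x := by
  unfold bayesRule
  rcases Real.sign_apply_eq (condProb ρ x - 1 / 2) with h | h | h <;> rw [h]
  · exact Real.sign_of_neg (by norm_num)
  · exact Real.sign_zero
  · exact Real.sign_of_pos one_pos

lemma abs_misclass_sub_le (ρ : Measure (X × ℝ)) [IsFiniteMeasure ρ] {f : X → ℝ}
    (hf : Measurable f) :
    |misclass ρ f - misclass ρ (bayesRule ρ)|
      ≤ ρ.fst.real {x | Real.sign (f x) ≠ bayesRule ρ x} := by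
  have hm : MeasurableSet {x | Real.sign (f x) ≠ bayesRule ρ x} :=
    (measurableSet_eq_fun (measurable_sign.comp hf) (measurable_bayesRule ρ)).compl
  have hD : ρ.fst.real {x | Real.sign (f x) ≠ bayesRule ρ x}
      = ρ.real {z | Real.sign (f z.1) ≠ bayesRule ρ z.1} := by
    rw [measureReal_def, Measure.fst_apply hm]; rfl
  have key : ∀ g h : X → ℝ, misclass ρ g ≤ misclass ρ h
      + ρ.real {z | Real.sign (g z.1) ≠ Real.sign (h z.1)} := by
    intro g h
    refine (measureReal_mono ?_).trans (measureReal_union_le _ _)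
    intro z hz
    by_cases e : Real.sign (g z.1) = Real.sign (h z.1)
    · left
      simpa only [Set.mem_ofPred_eq, ← e] using hz
    · exact Or.inr e
  have h1 := key f (bayesRule ρ)
  have h2 := key (bayesRule ρ) f
  simp only [sign_bayesRule] at h1 h2
  simp only [ne_comm (a := bayesRule ρ _)] at h2
  rw [hD, abs_le]
  constructor <;> linarith

/-- The sets of margin below 1/(k+1) decrease to the null set η = 1/2. -/
lemma exists_margin_measure_lt (ρ : Measure (X × ℝ)) [IsFiniteMeasure ρ]
    (hhalf : ∀ᵐ z ∂ρ, condProb ρ z.1 ≠ 1 / 2) {ε : ℝ≥0∞} (hε : 0 < ε) :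
    ∃ τ : ℝ, 0 < τ ∧ ρ.fst {x | |2 * condProb ρ x - 1| < τ} < ε := by
  have hmargin : Measurable fun x => |2 * condProb ρ x - 1| :=
    (((measurable_condProb ρ).const_mul 2).sub_const 1).abs
  have hanti : Antitone fun k : ℕ => {x | |2 * condProb ρ x - 1| < 1 / ((k : ℝ) + 1)} := by
    intro a b hab x hx
    have hab' : (a : ℝ) ≤ b := by exact_mod_cast hab
    exact lt_of_lt_of_le (b := 1 / ((b : ℝ) + 1)) hx
      (one_div_le_one_div_of_le (by positivity) (by linarith))
  have hlim := tendsto_measure_iInter_atTop (μ := ρ.fst)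
    (fun k => (measurableSet_lt hmargin measurable_const).nullMeasurableSet) hanti
    ⟨0, measure_ne_top _ _⟩
  have hzero : ρ.fst (⋂ k : ℕ, {x | |2 * condProb ρ x - 1| < 1 / ((k : ℝ) + 1)}) = 0 := by
    have hfst : ∀ᵐ x ∂ρ.fst, condProb ρ x ≠ 1 / 2 := by
      have hm : MeasurableSet {x | condProb ρ x ≠ 1 / 2} :=
        ((measurable_condProb ρ) (measurableSet_singleton _)).compl
      rw [Measure.fst, ae_map_iff measurable_fst.aemeasurable hm]
      exact hhalf
    refine measure_mono_null ?_ (ae_iff.1 hfst)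
    intro x hx
    rw [Set.mem_iInter] at hx
    simp only [ne_eq, not_not, Set.mem_ofPred_eq]
    by_contra hne
    obtain ⟨k, hk⟩ := exists_nat_one_div_lt
      (abs_pos.2 (show 2 * condProb ρ x - 1 ≠ 0 from fun h => hne (by linarith)))
    exact lt_asymm hk (hx k)
  rw [hzero] at hlim
  obtain ⟨k, hk⟩ := (hlim.eventually (gt_mem_nhds hε)).exists
  exact ⟨_, Nat.one_div_pos_of_nat, hk⟩

/-- A small excess `V_q`-risk forces agreement with the Bayes rule outside the set of points of
small margin. -/
lemma measure_sign_ne_bayesRule_le (hq : 0 < q) (ρ : Measure (X × ℝ)) [IsFiniteMeasure ρ]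
    (hlabel : ∀ᵐ z ∂ρ, z.2 = 1 ∨ z.2 = -1) {f : X → ℝ} (hf : Measurable f) {τ s : ℝ}
    (hτ : 0 < τ) (h : lossRisk q ρ (fun x => (f x : EReal))
      ≤ lossRisk q ρ (popMinimizer q ρ) + ENNReal.ofReal (q / (q + 1) * τ * s)) :
    ρ.fst {x | Real.sign (f x) ≠ bayesRule ρ x}
      ≤ ρ.fst {x | |2 * condProb ρ x - 1| < τ} + ENNReal.ofReal s := by
  have h1 := (ENNReal.add_le_add_iff_left (lossRisk_popMinimizer_ne_top hq ρ hlabel)).1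
    ((lossRisk_popMinimizer_add_le hq ρ hlabel hf).trans h)
  have hc : 0 < q / (q + 1) * τ := by positivity
  have hm : Measurable fun x => ENNReal.ofReal
      (if Real.sign (f x) = bayesRule ρ x then 0
        else q / (q + 1) * |2 * condProb ρ x - 1|) := by
    refine ENNReal.measurable_ofReal.comp (Measurable.ite ?_ measurable_const ?_)
    · exact measurableSet_eq_fun (measurable_sign.comp hf) (measurable_bayesRule ρ)
    · exact ((((measurable_condProb ρ).const_mul 2).sub_const 1).abs).const_mul _
  -- Markov's inequality: a wrong sign at margin at least τ costs at least q/(q+1)·τ.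
  have h2 := (mul_meas_ge_le_lintegral (μ := ρ.fst) hm
    (ENNReal.ofReal (q / (q + 1) * τ))).trans h1
  rw [ENNReal.ofReal_mul hc.le] at h2
  have h3 := (ENNReal.mul_le_mul_iff_right (by simpa using hc) ENNReal.ofReal_ne_top).1 h2
  refine (measure_mono ?_).trans ((measure_union_le _ _).trans (add_le_add_right h3 _))
  intro x hx
  by_cases hlt : |2 * condProb ρ x - 1| < τ
  · exact Or.inl hlt
  · right
    rw [Set.mem_ofPred_eq, if_neg hx]
    apply ENNReal.ofReal_le_ofReal
    rw [not_lt] at hlt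
    gcongr

end Misclassification

end DWD

theorem theorem1 {p : ℕ} (X : Set (EuclideanSpace ℝ (Fin p))) (hX : IsCompact X)
    -- the kernel `K` and its reproducing kernel Hilbert space `H`
    (K : X → X → ℝ) {H : Type*} [NormedAddCommGroup H] [InnerProductSpace ℝ H] [CompleteSpace H]
    [RKHS ℝ H X ℝ] (hK : DWD.IsRKHSOf H K) (hUniv : DWD.IsUniversal H)
    -- the exponent of the loss
    (q : ℝ) (hq : 0 < q)
    -- the joint law of `(X, Y)`, with labels in `{-1, 1}`
    (ρ : Measure (X × ℝ)) [IsProbabilityMeasure ρ]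
    (hlabel : ∀ᵐ z ∂ρ, z.2 = 1 ∨ z.2 = -1)
    (hhalf : ∀ᵐ z ∂ρ, DWD.condProb ρ z.1 ≠ 1 / 2)
    -- the i.i.d. training sample
    {Ω : Type*} [MeasurableSpace Ω] (P : Measure Ω) [IsProbabilityMeasure P]
    (Z : ℕ → Ω → X × ℝ) (hlaw : ∀ i, HasLaw (Z i) ρ P) (hindep : iIndepFun Z P)
    -- the kernel DWD estimators
    (lam : ℕ → ℝ) (fhat : ℕ → Ω → H)
    (hfhat : ∀ n, 1 ≤ n → ∀ ω, DWD.IsKernelDWD q (lam n) n (fun i => Z i ω) (fhat n ω)) :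
    DWD.approxError H q ρ = 0 ∧
    (BddAbove (Set.range fun x => K x x) →
      Tendsto lam atTop (𝓝 0) → Tendsto (fun n : ℕ => (n : ℝ) * lam n) atTop atTop →
      (∀ ε : ℝ, 0 < ε →
        Tendsto (fun n => P {ω | (ε : EReal) < DWD.estError q ρ (fhat n ω)}) atTop (𝓝 0)) ∧
      TendstoInMeasure P (fun n ω => DWD.misclass ρ (fhat n ω)) atTop
        (fun _ => DWD.misclass ρ (DWD.bayesRule ρ))) := by
  have : CompactSpace X := isCompact_iff_compactSpace.1 hX
  refine ⟨DWD.approxError_eq_zero hUniv hq ρ hlabel, fun hB hlam0 hlam => ?_⟩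
  obtain ⟨κ, hκ0, hκ⟩ := DWD.exists_abs_apply_le hK hB
  have hrisk := fun {ε : ℝ} (hε : 0 < ε) =>
    DWD.tendsto_measure_infRisk_add_lt_lossRisk hUniv hq hκ0 hκ ρ hlabel P Z hlaw hindep lam fhat
      hfhat hlam0 hlam hε
  have hfin := DWD.infRisk_ne_top hUniv hq ρ hlabel
  refine ⟨fun ε hε => ?_, ?_⟩
  · simpa only [DWD.lt_estError_iff hfin hε] using hrisk hε
  · rw [tendstoInMeasure_iff_dist]
    intro ε hε
    obtain ⟨τ, hτ, hτε⟩ := DWD.exists_margin_measure_lt ρ hhalf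
      (ε := ENNReal.ofReal (ε / 2)) (by simpa using hε)
    -- At this excess risk, wrong signs at margin at least τ have mass at most ε/2; smaller margins
    -- have mass below ε/2.
    refine tendsto_of_tendsto_of_tendsto_of_le_of_le tendsto_const_nhds
      (hrisk (ε := q / (q + 1) * τ * (ε / 2)) (by positivity)) (fun _ => zero_le)
      fun n => measure_mono fun ω hω => ?_
    by_contra hle
    rw [Set.mem_ofPred_eq, not_lt, DWD.infRisk_eq hUniv hq ρ hlabel] at hle
    have h1 := DWD.measure_sign_ne_bayesRule_le hq ρ hlabel (hUniv.measurable (fhat n ω)) hτ hle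
    have h2 := h1.trans_lt (ENNReal.add_lt_add_right ENNReal.ofReal_ne_top hτε)
    rw [← ENNReal.ofReal_add (half_pos hε).le (half_pos hε).le, add_halves] at h2
    have h3 := DWD.abs_misclass_sub_le ρ (hUniv.measurable (fhat n ω))
    have h4 : ρ.fst.real {x | Real.sign (fhat n ω x) ≠ DWD.bayesRule ρ x} < ε := by
      rw [measureReal_def]
      exact (ENNReal.lt_ofReal_iff_toReal_lt (measure_ne_top _ _)).1 h2
    rw [Set.mem_ofPred_eq, Real.dist_eq] at hω
    exact (h3.trans_lt h4).not_ge hω
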